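/- Let $N\ge 1$, $0<\alpha<2$ and $\lambda\in\mathbb C\setminus\{0\}$. For $s\ge 0$ and $1<p<\infty$ let $H^{s,p}(\mathbb R^N)$ be the space of tempered distributions $v$ with $\mathcal F^{-1}\big[(1+|\xi|^2)^{s/2}\,\mathcal F v\big]\in L^p(\mathbb R^N)$, and let $C_0(\mathbb R^N)$ be the space of continuous functions $\mathbb R^N\to\mathbb C$ vanishing at infinity, with the sup norm. Then there exists a complex-valued initial value $\varphi\in C_c^\infty(\mathbb R^N)$ with the following property. The Cauchy problem $$u_t=\Delta u+\lambda|u|^\alpha u,\qquad u(0,\cdot)=\varphi,$$ has a (unique) maximal solution $u\in C([0,T_{\max}),C_0(\mathbb R^N))$, $0<T_{\max}\le\infty$, that is, a solution in the sense of Duhamel's formula $$u(t)=e^{t\Delta}\varphi+\lambda\int_0^t e^{(t-s)\Delta}\,|u(s)|^\alpha u(s)\,ds,\qquad 0\le t<T_{\max},$$ which extends every other solution in $C([0,T'),C_0(\mathbb R^N))$; and there is $\delta\in(0,T_{\max}]$, $\delta<\infty$, such that for every $0<t<\delta$, $$u(t)\notin H^{s,p}(\mathbb R^N)\qquad\text{for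 all } 1<p<\infty \text{ and all } s>5+\tfrac1p .$$ -/

import Mathlib

open MeasureTheory
open scoped ZeroAtInfty ContDiff SchwartzMap ENNReal

noncomputable section

namespace SemilinearHeat

/-- The Gauss–Weierstrass kernel `(4πt)^(-N/2) exp(-|x|²/(4t))` on `ℝ^N`. -/
def heatKernel {N : ℕ} (t : ℝ) (x : EuclideanSpace ℝ (Fin N)) : ℝ :=
  (4 * Real.pi * t) ^ (-((N : ℝ) / 2)) * Real.exp (-(‖x‖ ^ 2) / (4 * t))

/-- The heat semigroup `e^{tΔ} f`: convolution with the heat kernel for `t > 0`, and the identity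
for `t = 0` (only `t ≥ 0` is used). -/
def heatSemigroup {N : ℕ} (t : ℝ) (f : EuclideanSpace ℝ (Fin N) → ℂ)
    (x : EuclideanSpace ℝ (Fin N)) : ℂ :=
  if 0 < t then ∫ y, heatKernel t (x - y) • f y else f x

/-- The nonlinearity `z ↦ |z|^α z`. -/
def powerNonlinearity (α : ℝ) (z : ℂ) : ℂ := ((‖z‖ ^ α : ℝ) : ℂ) * z

/-- `u ∈ C([0,T), C₀(ℝ^N))` is a (mild) solution of `u_t = Δu + lam |u|^α u`, `u(0) = φ`, i.e. it
satisfies Duhamel's formula on `[0,T)`. Here `T ≤ ∞`; values of `u` outside `[0,T)` are irrelevant.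
At `t = 0` the formula reads `u(0) = φ`. -/
structure IsSolution {N : ℕ} (α : ℝ) (lam : ℂ) (φ : EuclideanSpace ℝ (Fin N) → ℂ)
    (T : EReal) (u : ℝ → C₀(EuclideanSpace ℝ (Fin N), ℂ)) : Prop where
  continuousOn : ContinuousOn u {t : ℝ | 0 ≤ t ∧ (t : EReal) < T}
  duhamel : ∀ t : ℝ, 0 ≤ t → (t : EReal) < T → ∀ x : EuclideanSpace ℝ (Fin N),
    u t x = heatSemigroup t φ x +
      lam * ∫ s in (0 : ℝ)..t, heatSemigroup (t - s) (fun y => powerNonlinearity α (u s y)) x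

/-- `u` on `[0,T)` is the maximal solution with initial value `φ`: `T > 0`, it is a solution on
`[0,T)`, and it extends every solution on an interval `[0,T')`. -/
structure IsMaximalSolution {N : ℕ} (α : ℝ) (lam : ℂ) (φ : EuclideanSpace ℝ (Fin N) → ℂ)
    (T : EReal) (u : ℝ → C₀(EuclideanSpace ℝ (Fin N), ℂ)) : Prop where
  pos : 0 < T
  isSolution : IsSolution α lam φ T u
  extends_all : ∀ (T' : EReal) (v : ℝ → C₀(EuclideanSpace ℝ (Fin N), ℂ)),
    IsSolution α lam φ T' v →
      T' ≤ T ∧ ∀ t : ℝ, 0 ≤ t → (t : EReal) < T' → v t = u t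

/-- The maximal solution, if it exists, is unique. -/
theorem IsMaximalSolution.unique {N : ℕ} {α : ℝ} {lam : ℂ}
    {φ : EuclideanSpace ℝ (Fin N) → ℂ} {T T' : EReal}
    {u v : ℝ → C₀(EuclideanSpace ℝ (Fin N), ℂ)}
    (hu : IsMaximalSolution α lam φ T u) (hv : IsMaximalSolution α lam φ T' v) :
    T = T' ∧ ∀ t : ℝ, 0 ≤ t → (t : EReal) < T → u t = v t :=
  ⟨le_antisymm (hv.extends_all T u hu.isSolution).1 (hu.extends_all T' v hv.isSolution).1,
    (hv.extends_all T u hu.isSolution).2⟩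

theorem memLp_top {N : ℕ} (f : C₀(EuclideanSpace ℝ (Fin N), ℂ)) :
    MemLp (fun x => f x) ∞ (volume : Measure (EuclideanSpace ℝ (Fin N))) :=
  memLp_top_of_bound f.continuous.aestronglyMeasurable ‖f‖
    (Filter.Eventually.of_forall fun x => f.toBCF.norm_coe_le_norm x)

/-- The tempered distribution `g ↦ ∫ g f` given by a function `f ∈ C₀(ℝ^N)`. -/
def toDistribution {N : ℕ} (f : C₀(EuclideanSpace ℝ (Fin N), ℂ)) :
    𝓢'(EuclideanSpace ℝ (Fin N), ℂ) :=
  Lp.toTemperedDistribution ((memLp_top f).toLp (fun x => f x))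

theorem toDistribution_apply {N : ℕ} (f : C₀(EuclideanSpace ℝ (Fin N), ℂ))
    (g : 𝓢(EuclideanSpace ℝ (Fin N), ℂ)) : toDistribution f g = ∫ x, g x * f x := by
  rw [toDistribution, Lp.toTemperedDistribution_apply]
  refine integral_congr_ae ?_
  filter_upwards [(memLp_top f).coeFn_toLp] with x hx
  rw [hx, smul_eq_mul]

/-- `f ∈ H^{s,p}(ℝ^N)`, the Bessel potential space: the tempered distribution
`𝓕⁻¹[(1+|ξ|²)^{s/2} 𝓕 f]` belongs to `L^p`. -/
def MemHsp {N : ℕ} (s : ℝ) (p : ℝ≥0∞) [Fact (1 ≤ p)]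
    (f : C₀(EuclideanSpace ℝ (Fin N), ℂ)) : Prop :=
  TemperedDistribution.MemSobolev s p (toDistribution f)

end SemilinearHeat

end

noncomputable section

namespace SemilinearHeat

open Filter Topology FourierTransform LineDeriv Set

variable {N : ℕ}

local notation "𝔼" => EuclideanSpace ℝ (Fin N)

/-! The nonlinearity is not smooth at zeros of `u`, and one Duhamel integration gains only about two
derivatives. Take `φ` equal to `x i` near the origin, cut off evenly in every variable. Oddness in
`x i` is preserved by the flow, so `u` keeps vanishing on the hyperplane `x i = 0`. More precisely
`|u t x - φ x| ≤ C √t |x i|` (`IsSolution.exists_norm_sub_le`), so for small times `|u|^α u`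
inherits the singularity `|x i|^α x i`, homogeneous of degree `α + 1 < 3`.

This singularity is detected by pairing with minus the fifth derivative, in direction `i`, of a
Gaussian of width parameter `a` in that direction and about `1` in the others (`testFun`). Five
derivatives against degree `α + 1` give a real part at most `-κ a^(α/2-2) + C`
(`exists_re_integral_testFun_smul_powerC₀_le`). The heat semigroup is self-adjoint and adds its time
to the widths, so Duhamel's formula turns the pairing of `u t` into a harmless `φ` term plus `lam`
times the integral over `s` of pairings at width `a + (t - s)`. Since `α/2 - 2 < -1`, that integral
blows up like `a^(α/2-1)` as `a → 0` (`IsSolution.not_memHsp`).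

Membership of `u t` in `H^{s,p}` with `s > 5 + 1/p` forbids this. By duality the Bessel potential of
order `-s` falls on the test function, where it is a Gamma-weighted average over `r` of heat flows.
The dual Lebesgue norm at width `r` is of order `r^(-5/2-1/(2p))`, which the weight `r^(s/2-1)
e^(-r)` makes integrable. The pairings thus stay bounded as `a → 0`
(`exists_norm_integral_testFun_le_of_memHsp`).

The maximal solution comes from Picard iteration, a Gronwall-type uniqueness argument and gluing. -/

/-! ### Exponentials of quadratic forms as Schwartz functions -/

theorem one_add_pow_mul_exp_neg_sq_le (j : ℕ) {c : ℝ} (hc : 0 < c) {r : ℝ} (hr : 0 ≤ r) :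
    (1 + r) ^ j * Real.exp (-(c * r ^ 2)) ≤ j.factorial / c ^ j * Real.exp (5 / 4 * c) := by
  have h := Real.pow_div_factorial_le_exp (x := c * (1 + r)) (by positivity) j
  rw [div_le_iff₀ (by positivity), mul_pow] at h
  have h2 : (1 + r) ^ j ≤ j.factorial / c ^ j * Real.exp (c * (1 + r)) := by
    rw [div_mul_eq_mul_div, le_div_iff₀ (by positivity)]
    linarith
  calc (1 + r) ^ j * Real.exp (-(c * r ^ 2))
      ≤ j.factorial / c ^ j * Real.exp (c * (1 + r)) * Real.exp (-(c * r ^ 2)) := by gcongr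
    _ = j.factorial / c ^ j * Real.exp (c * (1 + r) + -(c * r ^ 2)) := by
        rw [Real.exp_add]; ring
    _ ≤ _ := by
        gcongr
        -- The maximum of `1 + r - r ^ 2` is `5 / 4`, attained at `r = 1 / 2`.
        nlinarith [mul_nonneg hc.le (sq_nonneg (r - 1 / 2))]

/-- `exp (-f)` as a Schwartz function, for `f` of temperate growth bounded below by a positive
quadratic form. -/
def expNegSchwartz {E : Type*} [NormedAddCommGroup E] [NormedSpace ℝ E] (f : E → ℝ)
    (hf : f.HasTemperateGrowth) {c : ℝ} (hc : 0 < c) (hfc : ∀ x, c * ‖x‖ ^ 2 ≤ f x) :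
    𝓢(E, ℝ) where
  toFun x := Real.exp (-f x)
  smooth' := Real.contDiff_exp.comp hf.1.neg
  decay' := by
    intro k n
    obtain ⟨m, C, hC, hD⟩ := hf.neg.norm_iteratedFDeriv_le_uniform n
    -- Faà di Bruno bound: every derivative of `exp` is `exp`, and the derivatives of `-f` up to
    -- order `n` share one polynomial bound. Using `1 + C` instead of `C` makes that bound at least
    -- `1`, hence at most its own powers.
    have key : ∀ x : E, ‖iteratedFDeriv ℝ n (fun x => Real.exp (-f x)) x‖ ≤
        n.factorial * Real.exp (-f x) * ((1 + C) * (1 + ‖x‖) ^ m) ^ n := by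
      intro x
      refine norm_iteratedFDeriv_comp_le (N := ∞) Real.contDiff_exp hf.1.neg
        (by exact_mod_cast le_top) x ?_ ?_
      · intro i _
        rw [norm_iteratedFDeriv_eq_norm_iteratedDeriv, iteratedDeriv_eq_iterate,
          Real.iter_deriv_exp, Real.norm_eq_abs, Real.abs_exp]
      · intro i hi hin
        have h1 : (1 : ℝ) ≤ (1 + C) * (1 + ‖x‖) ^ m :=
          one_le_mul_of_one_le_of_one_le (by linarith)
            (one_le_pow₀ (by linarith [norm_nonneg x]))
        calc _ ≤ C * (1 + ‖x‖) ^ m := hD i hin x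
          _ ≤ (1 + C) * (1 + ‖x‖) ^ m := by gcongr; linarith
          _ ≤ _ := le_self_pow₀ h1 (by omega)
    refine ⟨n.factorial * (1 + C) ^ n *
      ((k + m * n).factorial / c ^ (k + m * n) * Real.exp (5 / 4 * c)), fun x => ?_⟩
    calc ‖x‖ ^ k * ‖iteratedFDeriv ℝ n (fun x => Real.exp (-f x)) x‖
        ≤ (1 + ‖x‖) ^ k * (n.factorial * Real.exp (-(c * ‖x‖ ^ 2)) *
          ((1 + C) * (1 + ‖x‖) ^ m) ^ n) := by
          gcongr
          · linarith
          · refine (key x).trans ?_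
            gcongr
            exact hfc x
      _ = n.factorial * (1 + C) ^ n *
          ((1 + ‖x‖) ^ (k + m * n) * Real.exp (-(c * ‖x‖ ^ 2))) := by
          rw [mul_pow, ← pow_mul, pow_add]; ring
      _ ≤ _ := mul_le_mul_of_nonneg_left
          (one_add_pow_mul_exp_neg_sq_le _ hc (norm_nonneg x)) (by positivity)

/-! ### Anisotropic heat kernels and their Fourier transforms -/

/-- The one-dimensional Gauss–Weierstrass kernel. -/
def gauss (a y : ℝ) : ℝ := (√(4 * Real.pi * a))⁻¹ * Real.exp (-(y ^ 2 / (4 * a)))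

theorem gauss_nonneg (a y : ℝ) : 0 ≤ gauss a y := by unfold gauss; positivity

@[fun_prop]
theorem continuous_gauss (a : ℝ) : Continuous (gauss a) := by unfold gauss; fun_prop

theorem gauss_neg (a y : ℝ) : gauss a (-y) = gauss a y := by simp [gauss]

theorem gauss_le {a : ℝ} (ha : 0 < a) (y : ℝ) : gauss a y ≤ (√a)⁻¹ := by
  unfold gauss
  calc _ ≤ (√a)⁻¹ * 1 := by
        gcongr
        · nlinarith [Real.pi_gt_three]
        · exact Real.exp_le_one_iff.2 (by simp only [Left.neg_nonpos_iff]; positivity)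
    _ = _ := mul_one _

theorem integrable_gauss {a : ℝ} (ha : 0 < a) : Integrable (gauss a) := by
  unfold gauss
  refine Integrable.const_mul ?_ _
  convert integrable_exp_neg_mul_sq (b := 1 / (4 * a)) (by positivity) using 3
  ring

theorem integral_gauss {a : ℝ} (ha : 0 < a) : ∫ y, gauss a y = 1 := by
  unfold gauss
  have h := integral_gaussian (1 / (4 * a))
  have h' : ∀ y : ℝ, -(y ^ 2 / (4 * a)) = -(1 / (4 * a)) * y ^ 2 := fun y => by ring
  simp_rw [h', integral_const_mul, h]
  rw [show Real.pi / (1 / (4 * a)) = 4 * Real.pi * a by field_simp]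
  exact inv_mul_cancel₀ (by positivity)

theorem hasDerivAt_gauss {a : ℝ} (ha : 0 < a) (y : ℝ) :
    HasDerivAt (gauss a) (-(y / (2 * a)) * gauss a y) y := by
  unfold gauss
  have h := (((hasDerivAt_pow 2 y).div_const (4 * a)).fun_neg.exp.const_mul
    (√(4 * Real.pi * a))⁻¹)
  refine h.congr_deriv ?_
  push_cast
  field_simp
  ring

/-- Product of one-dimensional heat kernels at times `c i`. -/
def gaussProd (c : Fin N → ℝ) (x : 𝔼) : ℝ := ∏ i, gauss (c i) (x i)

theorem gaussProd_nonneg (c : Fin N → ℝ) (x : 𝔼) : 0 ≤ gaussProd c x :=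
  Finset.prod_nonneg fun _ _ => gauss_nonneg _ _

theorem gaussProd_neg (c : Fin N → ℝ) (x : 𝔼) : gaussProd c (-x) = gaussProd c x := by
  simp [gaussProd, gauss_neg]

@[fun_prop]
theorem continuous_gaussProd (c : Fin N → ℝ) : Continuous (gaussProd c) := by
  unfold gaussProd; fun_prop

theorem gaussProd_eq (c : Fin N → ℝ) (x : 𝔼) :
    gaussProd c x = (∏ i, (√(4 * Real.pi * c i))⁻¹) * Real.exp (-∑ i, x i ^ 2 / (4 * c i)) := by
  simp [gaussProd, gauss, Finset.prod_mul_distrib, ← Real.exp_sum]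

theorem heatKernel_eq_gaussProd {t : ℝ} (ht : 0 < t) (x : 𝔼) :
    heatKernel t x = gaussProd (fun _ => t) x := by
  rw [gaussProd_eq, heatKernel, EuclideanSpace.real_norm_sq_eq, ← Finset.sum_div, neg_div]
  congr 1
  rw [Finset.prod_const, Finset.card_univ, Fintype.card_fin, Real.sqrt_eq_rpow,
    ← Real.rpow_neg (by positivity), ← Real.rpow_natCast, ← Real.rpow_mul (by positivity)]
  congr 1
  ring

theorem quadratic_hasTemperateGrowth (c : Fin N → ℝ) :
    (fun x : 𝔼 => ∑ i, x i ^ 2 / (4 * c i)).HasTemperateGrowth := by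
  refine Function.HasTemperateGrowth.sum fun i _ => ?_
  have h : (fun x : 𝔼 => x i).HasTemperateGrowth :=
    (EuclideanSpace.proj (𝕜 := ℝ) i : 𝔼 →L[ℝ] ℝ).hasTemperateGrowth
  have := (h.pow 2).mul (Function.HasTemperateGrowth.const ((4 * c i)⁻¹))
  exact this

theorem exists_quadratic_lower_bound {c : Fin N → ℝ} (hc : ∀ i, 0 < c i) :
    ∃ b : ℝ, 0 < b ∧ ∀ x : 𝔼, b * ‖x‖ ^ 2 ≤ ∑ i, x i ^ 2 / (4 * c i) := by
  -- The summand `1` keeps the constant positive when there are no coordinates.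
  refine ⟨(4 * (1 + ∑ i, c i))⁻¹, ?_, fun x => ?_⟩
  · have : 0 ≤ ∑ i, c i := Finset.sum_nonneg fun i _ => (hc i).le
    positivity
  · rw [EuclideanSpace.real_norm_sq_eq, Finset.mul_sum]
    refine Finset.sum_le_sum fun i hi => ?_
    have h1 : c i ≤ ∑ j, c j := Finset.single_le_sum (fun j _ => (hc j).le) hi
    have h2 := hc i
    rw [div_eq_inv_mul]
    gcongr
    linarith

/-- `gaussProd c` as a complex-valued Schwartz function. -/
def gaussSchwartz (c : Fin N → ℝ) (hc : ∀ i, 0 < c i) : 𝓢(𝔼, ℂ) :=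
  SchwartzMap.postcompCLM (𝕜 := ℝ) Complex.ofRealCLM
    ((∏ i, (√(4 * Real.pi * c i))⁻¹) • expNegSchwartz _ (quadratic_hasTemperateGrowth c)
      (exists_quadratic_lower_bound hc).choose_spec.1
      (exists_quadratic_lower_bound hc).choose_spec.2)

theorem gaussSchwartz_apply (c : Fin N → ℝ) (hc : ∀ i, 0 < c i) (x : 𝔼) :
    gaussSchwartz c hc x = (gaussProd c x : ℂ) := by
  rw [gaussProd_eq]
  rfl

theorem integrable_gaussProd {c : Fin N → ℝ} (hc : ∀ i, 0 < c i) :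
    Integrable (gaussProd c : 𝔼 → ℝ) := by
  have h := ((gaussSchwartz c hc).integrable (μ := volume)).re
  simpa [gaussSchwartz_apply] using h

theorem integral_prod_coord {𝕜 : Type*} [RCLike 𝕜] (f : Fin N → ℝ → 𝕜) :
    ∫ x : 𝔼, ∏ i, f i (x i) = ∏ i, ∫ y, f i y := by
  rw [← integral_fintype_prod_volume_eq_prod,
    ← (PiLp.volume_preserving_toLp (Fin N)).integral_comp
    (MeasurableEquiv.toLp 2 _).measurableEmbedding]

theorem integral_gaussProd {c : Fin N → ℝ} (hc : ∀ i, 0 < c i) :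
    ∫ x : 𝔼, gaussProd c x = 1 := by
  unfold gaussProd
  rw [integral_prod_coord]
  exact Finset.prod_eq_one fun i _ => integral_gauss (hc i)

theorem fourier_gauss {a : ℝ} (ha : 0 < a) (ξ : ℝ) :
    𝓕 (fun y : ℝ => (gauss a y : ℂ)) ξ = ((Real.exp (-(4 * Real.pi ^ 2 * (a * ξ ^ 2))) : ℝ) : ℂ) := by
  have hπ : (Real.pi : ℂ) ≠ 0 := by exact_mod_cast Real.pi_ne_zero
  have ha' : (a : ℂ) ≠ 0 := by exact_mod_cast ha.ne'
  have h0 : (fun y : ℝ => (gauss a y : ℂ)) = fun y : ℝ => ((√(4 * Real.pi * a))⁻¹ : ℂ) •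
      Complex.exp (-(1 / (4 * a) : ℝ) * (‖y‖ : ℂ) ^ 2) := by
    ext y
    simp only [gauss, smul_eq_mul]
    rw [← Complex.ofReal_pow, Real.norm_eq_abs, sq_abs]
    push_cast
    congr 2
    ring
  have h := fourier_gaussian_innerProductSpace (V := ℝ) (b := (1 / (4 * a) : ℝ))
    (by rw [Complex.ofReal_re]; positivity) ξ
  rw [h0, Real.fourier_eq'] at *
  simp_rw [smul_comm (Complex.exp _) ((√(4 * Real.pi * a))⁻¹ : ℂ)]
  rw [integral_smul, h]
  have h1 : ((Real.pi : ℂ) / ((1 / (4 * a) : ℝ) : ℂ)) ^ ((Module.finrank ℝ ℝ : ℂ) / 2) =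
      (√(4 * Real.pi * a) : ℂ) := by
    rw [Real.sqrt_eq_rpow, Complex.ofReal_cpow (by positivity)]
    simp only [Module.finrank_self]
    push_cast
    congr 1
    field_simp
  rw [h1, smul_eq_mul, ← mul_assoc, inv_mul_cancel₀, one_mul]
  · have h2 : ((‖ξ‖ : ℝ) : ℂ) ^ 2 = (ξ : ℂ) ^ 2 := by
      rw [← Complex.ofReal_pow, Real.norm_eq_abs, sq_abs, Complex.ofReal_pow]
    rw [h2]
    push_cast
    congr 1
    field_simp
  · exact_mod_cast (by positivity : √(4 * Real.pi * a) ≠ 0)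

theorem fourier_gaussSchwartz (c : Fin N → ℝ) (hc : ∀ i, 0 < c i) (ξ : 𝔼) :
    𝓕 (gaussSchwartz c hc) ξ =
      ((Real.exp (-(4 * Real.pi ^ 2 * ∑ i, c i * ξ i ^ 2)) : ℝ) : ℂ) := by
  rw [SchwartzMap.fourier_coe, Real.fourier_eq']
  simp only [gaussSchwartz_apply, gaussProd]
  have h : ∀ v : 𝔼, Complex.exp (((-2 * Real.pi * inner ℝ v ξ : ℝ) : ℂ) * Complex.I) •
      ((∏ i, gauss (c i) (v i) : ℝ) : ℂ) = ∏ i, (fun (i : Fin N) (y : ℝ) =>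
        Complex.exp (((-2 * Real.pi * inner ℝ y (ξ i) : ℝ) : ℂ) * Complex.I) •
          (gauss (c i) y : ℂ)) i (v i) := by
    intro v
    simp only [smul_eq_mul, Finset.prod_mul_distrib, ← Complex.exp_sum, PiLp.inner_apply]
    push_cast
    rw [Finset.mul_sum, Finset.sum_mul]
  rw [integral_congr_ae (Eventually.of_forall h)]
  refine (integral_prod_coord (fun (i : Fin N) (y : ℝ) =>
    Complex.exp (((-2 * Real.pi * inner ℝ y (ξ i) : ℝ) : ℂ) * Complex.I) •
      (gauss (c i) y : ℂ))).trans ?_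
  rw [Finset.mul_sum, ← Finset.sum_neg_distrib, Real.exp_sum,
    Complex.ofReal_prod]
  refine Finset.prod_congr rfl fun i _ => ?_
  rw [← fourier_gauss (hc i), Real.fourier_eq']

/-! ### Test functions: fifth derivatives of heat kernels -/

/-- The polynomial `H` with `-∂⁵ (gauss a) = H * gauss a`. -/
def hermFactor (a y : ℝ) : ℝ :=
  y ^ 5 / (2 * a) ^ 5 - 10 * y ^ 3 / (2 * a) ^ 4 + 15 * y / (2 * a) ^ 3

/-- The test functions: minus the fifth derivative of `gaussProd c` in the direction `i`. -/
def testFun (i : Fin N) (c : Fin N → ℝ) (x : 𝔼) : ℝ := hermFactor (c i) (x i) * gaussProd c x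

/-- `testFun i c` as a Schwartz function. -/
def testSchwartz (i : Fin N) (c : Fin N → ℝ) (hc : ∀ i, 0 < c i) : 𝓢(𝔼, ℂ) :=
  -(∂_{(EuclideanSpace.single i (1 : ℝ) : 𝔼)} (∂_{(EuclideanSpace.single i (1 : ℝ) : 𝔼)}
    (∂_{(EuclideanSpace.single i (1 : ℝ) : 𝔼)} (∂_{(EuclideanSpace.single i (1 : ℝ) : 𝔼)}
      (∂_{(EuclideanSpace.single i (1 : ℝ) : 𝔼)} (gaussSchwartz c hc))))))

theorem gaussProd_add_smul_single (i : Fin N) (c : Fin N → ℝ) (x : 𝔼) (s : ℝ) :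
    gaussProd c (x + s • EuclideanSpace.single i (1 : ℝ)) =
      gauss (c i) (x i + s) * ∏ j ∈ Finset.univ.erase i, gauss (c j) (x j) := by
  rw [gaussProd, ← Finset.mul_prod_erase _ _ (Finset.mem_univ i)]
  congr 1
  · simp
  · refine Finset.prod_congr rfl fun j hj => ?_
    simp [Finset.ne_of_mem_erase hj]

/-- The logarithmic derivative of the kernel is `-x i / (2 * c i)`, so differentiation acts on
polynomial prefactors by `P ↦ P' - y P / (2 * c i)`. Iterating from `P = 1` produces the Hermite
prefactors. -/
theorem lineDerivOp_mul_gaussProd (i : Fin N) {c : Fin N → ℝ} (hc : ∀ i, 0 < c i)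
    {f : 𝓢(𝔼, ℂ)} {P P' : ℝ → ℝ} (hP : ∀ y, HasDerivAt P (P' y) y)
    (hf : ∀ x : 𝔼, f x = ((P (x i) * gaussProd c x : ℝ) : ℂ)) (x : 𝔼) :
    ∂_{(EuclideanSpace.single i (1 : ℝ) : 𝔼)} f x =
      (((P' (x i) - x i / (2 * c i) * P (x i)) * gaussProd c x : ℝ) : ℂ) := by
  rw [SchwartzMap.lineDerivOp_apply]
  refine HasLineDerivAt.lineDeriv ?_
  unfold HasLineDerivAt
  simp only [hf, gaussProd_add_smul_single]
  have h1 := hP (x i + 0)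
  have h2 := hasDerivAt_gauss (hc i) (x i + 0)
  have h := ((h1.comp_const_add (x i) 0).mul ((h2.comp_const_add (x i) 0).mul_const
    (∏ j ∈ Finset.univ.erase i, gauss (c j) (x j)))).ofReal_comp
  simp only [PiLp.add_apply, PiLp.smul_apply, PiLp.single_apply, if_true, smul_eq_mul,
    mul_one]
  refine h.congr_deriv ?_
  have h3 := gaussProd_add_smul_single i c x 0
  rw [zero_smul, add_zero] at h3
  rw [h3]
  simp only [add_zero]
  congr 1
  ring

theorem testSchwartz_apply (i : Fin N) (c : Fin N → ℝ) (hc : ∀ i, 0 < c i) (x : 𝔼) :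
    testSchwartz i c hc x = (testFun i c x : ℂ) := by
  have h0 : ∀ x : 𝔼, gaussSchwartz c hc x = (((fun _ : ℝ => (1 : ℝ)) (x i) * gaussProd c x : ℝ) : ℂ) :=
    fun x => by rw [gaussSchwartz_apply, one_mul]
  set b := 2 * c i with hb
  have hb0 : b ≠ 0 := by have := hc i; positivity
  have h1 := lineDerivOp_mul_gaussProd i hc (fun y => hasDerivAt_const y (1 : ℝ)) h0
  -- Each `P` is kept in the unsimplified form returned by the previous step so that the hypotheses
  -- chain; `P'` is simplified.
  have h2 := lineDerivOp_mul_gaussProd i hc (P := fun y => 0 - y / b * 1) (P' := fun y => -(1 / b))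
    (fun y => by
      refine ((((hasDerivAt_id' y).div_const b).mul_const 1).const_sub 0).congr_deriv ?_
      ring) h1
  have h3 := lineDerivOp_mul_gaussProd i hc
    (P := fun y => -(1 / b) - y / b * (0 - y / b * 1)) (P' := fun y => 2 * y / b ^ 2)
    (fun y => by
      refine HasDerivAt.congr_of_eventuallyEq (f := fun y => -(1 / b) + y ^ 2 / b ^ 2) ?_
        (Eventually.of_forall fun y => by ring)
      refine (((hasDerivAt_pow 2 y).div_const (b ^ 2)).const_add _).congr_deriv ?_
      push_cast; ring) h2
  have h4 := lineDerivOp_mul_gaussProd i hc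
    (P := fun y => 2 * y / b ^ 2 - y / b * (-(1 / b) - y / b * (0 - y / b * 1)))
    (P' := fun y => 3 / b ^ 2 - 3 * y ^ 2 / b ^ 3)
    (fun y => by
      refine HasDerivAt.congr_of_eventuallyEq (f := fun y => 3 * y / b ^ 2 - y ^ 3 / b ^ 3) ?_
        (Eventually.of_forall fun y => by ring)
      refine ((((hasDerivAt_id' y).const_mul 3).div_const (b ^ 2)).fun_sub
        ((hasDerivAt_pow 3 y).div_const (b ^ 3))).congr_deriv ?_
      push_cast; ring) h3
  have h5 := lineDerivOp_mul_gaussProd i hc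
    (P := fun y => 3 / b ^ 2 - 3 * y ^ 2 / b ^ 3 -
      y / b * (2 * y / b ^ 2 - y / b * (-(1 / b) - y / b * (0 - y / b * 1))))
    (P' := fun y => -(12 * y / b ^ 3) + 4 * y ^ 3 / b ^ 4)
    (fun y => by
      refine HasDerivAt.congr_of_eventuallyEq
        (f := fun y => 3 / b ^ 2 + -(6 * y ^ 2 / b ^ 3) + y ^ 4 / b ^ 4) ?_
        (Eventually.of_forall fun y => by ring)
      refine (((((hasDerivAt_pow 2 y).const_mul 6).div_const (b ^ 3)).fun_neg.const_add _).fun_add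
        ((hasDerivAt_pow 4 y).div_const (b ^ 4))).congr_deriv ?_
      push_cast; ring) h4 x
  rw [testSchwartz, neg_apply, h5, testFun, hermFactor, ← Complex.ofReal_neg]
  congr 1
  rw [← hb]
  ring

theorem fourier_testSchwartz (i : Fin N) (c : Fin N → ℝ) (hc : ∀ i, 0 < c i) (ξ : 𝔼) :
    𝓕 (testSchwartz i c hc) ξ = -(2 * Real.pi * Complex.I * ξ i) ^ 5 *
      ((Real.exp (-(4 * Real.pi ^ 2 * ∑ i, c i * ξ i ^ 2)) : ℝ) : ℂ) := by
  have ht : (inner ℝ · (EuclideanSpace.single i (1 : ℝ) : 𝔼)).HasTemperateGrowth := by fun_prop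
  have h : ∀ (f : 𝓢(𝔼, ℂ)) (ξ : 𝔼), 𝓕 (∂_{(EuclideanSpace.single i (1 : ℝ) : 𝔼)} f) ξ =
      (2 * Real.pi * Complex.I * ξ i) * 𝓕 f ξ := by
    intro f ξ
    rw [SchwartzMap.fourier_lineDerivOp_eq, smul_apply,
      SchwartzMap.smulLeftCLM_apply_apply ht, EuclideanSpace.inner_single_right]
    simp [mul_assoc]
  rw [testSchwartz, FourierTransform.fourier_neg, neg_apply, h, h, h, h, h,
    fourier_gaussSchwartz]
  ring

/-- Convolution of the heat kernel with a test function. -/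
theorem integral_gaussProd_mul_testFun (i : Fin N) {τ : ℝ} (hτ : 0 < τ) {c : Fin N → ℝ}
    (hc : ∀ i, 0 < c i) (x : 𝔼) :
    ∫ y, gaussProd (fun _ => τ) (x - y) * testFun i c y = testFun i (fun j => c j + τ) x := by
  have hcτ : ∀ j, 0 < c j + τ := fun j => add_pos (hc j) hτ
  have h : SchwartzMap.convolution (ContinuousLinearMap.mul ℂ ℂ) (testSchwartz i c hc)
      (gaussSchwartz (fun _ : Fin N => τ) fun _ => hτ) =
      testSchwartz i (fun j => c j + τ) hcτ := by
    -- On the Fourier side convolution is multiplication, the Gaussian exponents add, and the factor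
    -- from the five derivatives is untouched.
    apply (fourierEquiv ℂ 𝓢(𝔼, ℂ)).injective
    rw [fourierEquiv_apply, fourierEquiv_apply, SchwartzMap.fourier_convolution]
    ext ξ
    rw [SchwartzMap.pairing_apply_apply, fourier_testSchwartz, fourier_testSchwartz,
      fourier_gaussSchwartz, ContinuousLinearMap.mul_apply', mul_assoc, ← Complex.ofReal_mul,
      ← Real.exp_add]
    congr 4
    simp only [add_mul, Finset.sum_add_distrib]
    ring
  have h2 := congrArg (fun f : 𝓢(𝔼, ℂ) => f x) h
  simp only [SchwartzMap.convolution_apply, convolution, ContinuousLinearMap.mul_apply',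
    testSchwartz_apply, gaussSchwartz_apply] at h2
  rw [← Complex.ofReal_inj, ← h2, ← integral_complex_ofReal]
  congr 1
  ext y
  push_cast
  ring

@[fun_prop]
theorem continuous_hermFactor (a : ℝ) : Continuous (hermFactor a) := by
  unfold hermFactor; fun_prop

theorem continuous_testFun (i : Fin N) (c : Fin N → ℝ) : Continuous (testFun i c) := by
  unfold testFun
  have : Continuous fun x : 𝔼 => x i := by fun_prop
  exact ((continuous_hermFactor _).comp this).mul (continuous_gaussProd c)

/-! ### Size estimates for the test functions -/

/-- Half of the Gaussian exponent stays in a kernel of doubled width; the other half is set aside to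
absorb polynomial factors in `|y| / √a`. -/
theorem gauss_eq_mul_gauss_two_mul {a : ℝ} (ha : 0 < a) (y : ℝ) :
    gauss a y = √2 * gauss (2 * a) y * Real.exp (-(1 / 8 * (|y| / √a) ^ 2)) := by
  have h1 : √(4 * Real.pi * (2 * a)) = √2 * √(4 * Real.pi * a) := by
    rw [← Real.sqrt_mul (by norm_num)]
    congr 1
    ring
  have h2 : (|y| / √a) ^ 2 = y ^ 2 / a := by rw [div_pow, sq_abs, Real.sq_sqrt ha.le]
  unfold gauss
  have h3 : Real.exp (-(y ^ 2 / (4 * a))) =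
      Real.exp (-(y ^ 2 / (4 * (2 * a)))) * Real.exp (-(1 / 8 * (y ^ 2 / a))) := by
    rw [← Real.exp_add]
    congr 1
    field_simp
    ring
  rw [h1, h2, h3, mul_inv]
  field_simp

/-- Parabolic scaling: with `a = r ^ 2` and `y = r * z` the factor is `r⁻⁵` times a fixed quintic in
`z`, whose coefficients are small enough for `2 * (1 + |z|) ^ 5` to dominate it. -/
theorem abs_hermFactor_le {a : ℝ} (ha : 0 < a) (y : ℝ) :
    |hermFactor a y| ≤ 2 * a ^ (-(5 / 2) : ℝ) * (1 + |y| / √a) ^ 5 := by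
  obtain ⟨r, hr, rfl⟩ : ∃ r : ℝ, 0 < r ∧ a = r ^ 2 :=
    ⟨√a, Real.sqrt_pos.2 ha, (Real.sq_sqrt ha.le).symm⟩
  obtain ⟨z, rfl⟩ : ∃ z : ℝ, y = r * z := ⟨y / r, by field_simp⟩
  rw [Real.sqrt_sq hr.le, abs_mul, abs_of_pos hr, mul_div_cancel_left₀ _ hr.ne',
    ← Real.rpow_natCast r 2, ← Real.rpow_mul hr.le]
  have h1 : r ^ (((2 : ℕ) : ℝ) * -(5 / 2)) = (r ^ 5)⁻¹ := by
    rw [← Real.rpow_natCast r 5, ← Real.rpow_neg hr.le]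
    norm_num
  have h2 : hermFactor (r ^ ((2 : ℕ) : ℝ)) (r * z) =
      (r ^ 5)⁻¹ * (z ^ 5 / 32 - 10 / 16 * z ^ 3 + 15 / 8 * z) := by
    rw [Real.rpow_natCast, hermFactor]
    field_simp
    ring
  rw [h1, h2, abs_mul, abs_of_pos (by positivity), mul_comm (2 : ℝ), mul_assoc]
  gcongr
  have h3 : |z ^ 5 / 32 - 10 / 16 * z ^ 3 + 15 / 8 * z| ≤
      |z| ^ 5 / 32 + 10 / 16 * |z| ^ 3 + 15 / 8 * |z| := by
    refine (abs_add_le _ _).trans (add_le_add ((abs_sub _ _).trans (le_of_eq ?_)) (le_of_eq ?_))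
    · simp [abs_mul, abs_div, abs_pow]
    · rw [abs_mul, abs_of_pos (by norm_num : (0 : ℝ) < 15 / 8)]
  refine h3.trans ?_
  have hz := abs_nonneg z
  set w := |z|
  have := pow_nonneg hz 2
  have := pow_nonneg hz 3
  have := pow_nonneg hz 4
  have := pow_nonneg hz 5
  nlinarith

/-- By scaling, `|y| ^ β` is worth `a ^ (β / 2)` and five derivatives cost `a ^ (-5 / 2)`. It serves
with `β = 0` for sizes, `β = α + 1` for the nonlinear term, and `β = 5`, where no power of `a` is
left, for cutoff errors. -/
theorem exists_abs_rpow_mul_hermFactor_le {β : ℝ} (hβ : 0 ≤ β) : ∃ C : ℝ, 0 < C ∧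
    ∀ a : ℝ, 0 < a → ∀ y : ℝ, |y| ^ β * (|hermFactor a y| * gauss a y) ≤
      C * a ^ (β / 2 - 5 / 2) * gauss (2 * a) y := by
  set m := ⌈β⌉₊ + 5 with hm
  refine ⟨2 * √2 * (m.factorial / (1 / 8) ^ m * Real.exp (5 / 4 * (1 / 8))), by positivity, ?_⟩
  intro a ha y
  set z := |y| / √a with hz
  have hz0 : 0 ≤ z := by positivity
  have hy : |y| ^ β ≤ a ^ (β / 2) * (1 + z) ^ ⌈β⌉₊ := by
    have h1 : |y| = √a * z := by rw [hz]; field_simp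
    rw [h1, Real.mul_rpow (by positivity) hz0, Real.sqrt_eq_rpow, ← Real.rpow_mul ha.le,
      one_div_mul_eq_div]
    gcongr
    calc z ^ β ≤ (1 + z) ^ β := by gcongr; linarith
      _ ≤ (1 + z) ^ ((⌈β⌉₊ : ℕ) : ℝ) :=
        Real.rpow_le_rpow_of_exponent_le (by linarith) (Nat.le_ceil β)
      _ = _ := Real.rpow_natCast _ _
  have hg := gauss_nonneg (2 * a) y
  calc |y| ^ β * (|hermFactor a y| * gauss a y)
      ≤ (a ^ (β / 2) * (1 + z) ^ ⌈β⌉₊) * ((2 * a ^ (-(5 / 2) : ℝ) * (1 + z) ^ 5) *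
        (√2 * gauss (2 * a) y * Real.exp (-(1 / 8 * z ^ 2)))) := by
        rw [gauss_eq_mul_gauss_two_mul ha y]
        gcongr
        exact abs_hermFactor_le ha y
    _ = 2 * √2 * ((1 + z) ^ m * Real.exp (-(1 / 8 * z ^ 2))) *
        (a ^ (β / 2) * a ^ (-(5 / 2) : ℝ)) * gauss (2 * a) y := by
        rw [hm, pow_add]; ring
    _ ≤ 2 * √2 * (m.factorial / (1 / 8) ^ m * Real.exp (5 / 4 * (1 / 8))) *
        (a ^ (β / 2) * a ^ (-(5 / 2) : ℝ)) * gauss (2 * a) y := by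
        gcongr ?_ * _ * _
        refine mul_le_mul_of_nonneg_left ?_ (by positivity)
        exact one_add_pow_mul_exp_neg_sq_le m (by norm_num) hz0
    _ = _ := by rw [← Real.rpow_add ha, sub_eq_add_neg]

theorem gaussProd_eq_mul (i : Fin N) (c : Fin N → ℝ) (x : 𝔼) :
    gaussProd c x = gauss (c i) (x i) * ∏ j ∈ Finset.univ.erase i, gauss (c j) (x j) := by
  rw [gaussProd, ← Finset.mul_prod_erase _ _ (Finset.mem_univ i)]

theorem gaussProd_update (i : Fin N) (c : Fin N → ℝ) (b : ℝ) (x : 𝔼) :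
    gaussProd (Function.update c i b) x =
      gauss b (x i) * ∏ j ∈ Finset.univ.erase i, gauss (c j) (x j) := by
  rw [gaussProd_eq_mul i, Function.update_self]
  congr 1
  refine Finset.prod_congr rfl fun j hj => ?_
  rw [Function.update_of_ne (Finset.ne_of_mem_erase hj)]

theorem exists_abs_rpow_mul_testFun_le {β : ℝ} (hβ : 0 ≤ β) : ∃ C : ℝ, 0 < C ∧
    ∀ (i : Fin N) (c : Fin N → ℝ), (∀ j, 0 < c j) → ∀ x : 𝔼, |x i| ^ β * |testFun i c x| ≤
      C * c i ^ (β / 2 - 5 / 2) * gaussProd (Function.update c i (2 * c i)) x := by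
  obtain ⟨C, hC, h⟩ := exists_abs_rpow_mul_hermFactor_le hβ
  refine ⟨C, hC, fun i c hc x => ?_⟩
  have hP : 0 ≤ ∏ j ∈ Finset.univ.erase i, gauss (c j) (x j) :=
    Finset.prod_nonneg fun _ _ => gauss_nonneg _ _
  rw [gaussProd_update, testFun, abs_mul, abs_of_nonneg (gaussProd_nonneg c x),
    gaussProd_eq_mul i c x]
  calc _ = |x i| ^ β * (|hermFactor (c i) (x i)| * gauss (c i) (x i)) *
        ∏ j ∈ Finset.univ.erase i, gauss (c j) (x j) := by ring
    _ ≤ (C * c i ^ (β / 2 - 5 / 2) * gauss (2 * c i) (x i)) *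
        ∏ j ∈ Finset.univ.erase i, gauss (c j) (x j) :=
        mul_le_mul_of_nonneg_right (h (c i) (hc i) (x i)) hP
    _ = _ := by ring

theorem update_two_mul_pos (i : Fin N) {c : Fin N → ℝ} (hc : ∀ j, 0 < c j) (j : Fin N) :
    0 < Function.update c i (2 * c i) j := by
  rcases eq_or_ne j i with rfl | h
  · simpa using hc j
  · simpa [h] using hc j

theorem gaussProd_le {i : Fin N} {c : Fin N → ℝ} (hi : 0 < c i) (hc : ∀ j, j ≠ i → 1 ≤ c j)
    (x : 𝔼) : gaussProd c x ≤ (√(c i))⁻¹ := by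
  rw [gaussProd_eq_mul i]
  have h : ∏ j ∈ Finset.univ.erase i, gauss (c j) (x j) ≤ 1 := by
    refine Finset.prod_le_one (fun _ _ => gauss_nonneg _ _) fun j hj => ?_
    have h1 := hc j (Finset.ne_of_mem_erase hj)
    refine (gauss_le (by linarith) _).trans (inv_le_one_of_one_le₀ ?_)
    exact Real.one_le_sqrt.2 h1
  calc _ ≤ (√(c i))⁻¹ * 1 := by
        gcongr
        · exact Finset.prod_nonneg fun _ _ => gauss_nonneg _ _
        · exact gauss_le hi _
    _ = _ := mul_one _

theorem gaussProd_update_le {i : Fin N} {c : Fin N → ℝ} (hi : 0 < c i)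
    (hc : ∀ j, j ≠ i → 1 ≤ c j) (x : 𝔼) :
    gaussProd (Function.update c i (2 * c i)) x ≤ c i ^ (-(1 / 2) : ℝ) := by
  refine (gaussProd_le (i := i) (by simpa using hi) (fun j hj => by simpa [hj] using hc j hj)
    x).trans ?_
  rw [Function.update_self, Real.rpow_neg hi.le, ← Real.sqrt_eq_rpow]
  gcongr
  linarith

/-- The exponent is `-3 = -5/2 - 1/2`: five derivatives, and the height of the kernel in direction
`i`; the other directions contribute a bounded factor because their widths are at least `1`. -/
theorem exists_abs_testFun_le : ∃ C : ℝ, 0 < C ∧ ∀ (i : Fin N) (c : Fin N → ℝ), 0 < c i →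
    (∀ j, j ≠ i → 1 ≤ c j) → ∀ x : 𝔼, |testFun i c x| ≤ C * c i ^ (-3 : ℝ) := by
  obtain ⟨C, hC, h⟩ := exists_abs_rpow_mul_testFun_le (N := N) le_rfl
  refine ⟨C, hC, fun i c hi hc x => ?_⟩
  have hc0 : ∀ j, 0 < c j := fun j => by
    rcases eq_or_ne j i with rfl | hj
    · exact hi
    · linarith [hc j hj]
  have h1 := h i c hc0 x
  rw [Real.rpow_zero, one_mul] at h1
  refine h1.trans ?_
  calc _ ≤ C * c i ^ ((0 : ℝ) / 2 - 5 / 2) * c i ^ (-(1 / 2) : ℝ) := by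
        gcongr
        exact gaussProd_update_le hi hc x
    _ = _ := by rw [mul_assoc, ← Real.rpow_add hi]; norm_num

theorem integrable_testFun (i : Fin N) {c : Fin N → ℝ} (hc : ∀ j, 0 < c j) :
    Integrable (testFun i c : 𝔼 → ℝ) := by
  have h := ((testSchwartz i c hc).integrable (μ := volume)).re
  simpa [testSchwartz_apply] using h

theorem exists_integral_abs_rpow_mul_testFun_le {β : ℝ} (hβ : 0 ≤ β) : ∃ C : ℝ, 0 < C ∧
    ∀ (i : Fin N) (c : Fin N → ℝ), (∀ j, 0 < c j) →
      Integrable (fun x : 𝔼 => |x i| ^ β * |testFun i c x|) ∧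
      ∫ x : 𝔼, |x i| ^ β * |testFun i c x| ≤ C * c i ^ (β / 2 - 5 / 2) := by
  obtain ⟨C, hC, h⟩ := exists_abs_rpow_mul_testFun_le (N := N) hβ
  refine ⟨C, hC, fun i c hc => ?_⟩
  have hint := (integrable_gaussProd (update_two_mul_pos i hc)).const_mul
    (C * c i ^ (β / 2 - 5 / 2))
  have hint' : Integrable (fun x : 𝔼 => |x i| ^ β * |testFun i c x|) := by
    refine hint.mono' ?_ (Eventually.of_forall fun x => ?_)
    · have h1 : Continuous fun x : 𝔼 => |x i| ^ β :=
        (by fun_prop : Continuous fun x : 𝔼 => |x i|).rpow_const fun _ => Or.inr hβ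
      exact (h1.mul (continuous_testFun i c).abs).aestronglyMeasurable
    · rw [Real.norm_of_nonneg (by positivity)]
      exact h i c hc x
  refine ⟨hint', (integral_mono hint' hint fun x => h i c hc x).trans ?_⟩
  rw [integral_const_mul, integral_gaussProd (update_two_mul_pos i hc), mul_one]

/-- Pairing of an `L^p` function with a test function. -/
theorem exists_lintegral_mul_testFun_le {p : ℝ} (hp : 1 < p) : ∃ C : ℝ, 0 < C ∧
    ∀ (i : Fin N) (c : Fin N → ℝ), 0 < c i → (∀ j, j ≠ i → 1 ≤ c j) →
      ∀ w : 𝔼 → ℝ≥0∞, AEMeasurable w → ∫⁻ x, w x * ENNReal.ofReal |testFun i c x| ≤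
        (∫⁻ x, w x ^ p) ^ (1 / p) * ENNReal.ofReal (C * c i ^ (-(5 / 2) - 1 / (2 * p))) := by
  obtain ⟨C, hC, h⟩ := exists_abs_rpow_mul_testFun_le (N := N) le_rfl
  refine ⟨C, hC, fun i c hi hc w hw => ?_⟩
  have hc0 : ∀ j, 0 < c j := fun j => by
    rcases eq_or_ne j i with rfl | hj
    · exact hi
    · linarith [hc j hj]
  set K : 𝔼 → ℝ := gaussProd (Function.update c i (2 * c i)) with hK
  have hKi := integrable_gaussProd (update_two_mul_pos i hc0)
  set q := p.conjExponent with hq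
  have hpq : p.HolderConjugate q := Real.HolderConjugate.conjExponent hp
  -- Interpolation between mass `1` and height `c i ^ (-1/2)`: the exponent is `(q - 1) / (2q) = 1 /
  -- (2p)`.
  have hKq : (∫⁻ x, ENNReal.ofReal (K x) ^ q) ^ (1 / q) ≤
      ENNReal.ofReal (c i ^ (-(1 / (2 * p)))) := by
    have h1 : ∀ x, ENNReal.ofReal (K x) ^ q ≤
        ENNReal.ofReal ((c i ^ (-(1 / 2) : ℝ)) ^ (q - 1)) * ENNReal.ofReal (K x) := by
      intro x
      have hKx : 0 ≤ K x := gaussProd_nonneg _ _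
      rw [ENNReal.ofReal_rpow_of_nonneg hKx hpq.symm.nonneg,
        ← ENNReal.ofReal_mul (by positivity)]
      refine ENNReal.ofReal_le_ofReal ?_
      calc K x ^ q = K x ^ (q - 1) * K x := by
            rw [← Real.rpow_add_one' hKx (by rw [sub_add_cancel]; exact hpq.symm.ne_zero),
              sub_add_cancel]
        _ ≤ _ := by
            gcongr
            · exact hpq.symm.sub_one_pos.le
            · exact gaussProd_update_le hi hc x
    have h2 : ∫⁻ x, ENNReal.ofReal (K x) = 1 := by
      rw [← ofReal_integral_eq_lintegral_ofReal hKi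
        (Eventually.of_forall fun x => gaussProd_nonneg _ _),
        integral_gaussProd (update_two_mul_pos i hc0), ENNReal.ofReal_one]
    calc _ ≤ (ENNReal.ofReal ((c i ^ (-(1 / 2) : ℝ)) ^ (q - 1))) ^ (1 / q) := by
          refine ENNReal.rpow_le_rpow ?_ (by have := hpq.symm.pos; positivity)
          refine (lintegral_mono h1).trans ?_
          rw [lintegral_const_mul' _ _ ENNReal.ofReal_ne_top, h2, mul_one]
      _ = _ := by
          have h3 := hpq.symm.pos
          rw [ENNReal.ofReal_rpow_of_nonneg (by positivity) (by positivity),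
            ← Real.rpow_mul (by positivity), ← Real.rpow_mul hi.le]
          congr 2
          have h4 := hpq.inv_add_inv_eq_one
          have h5 := hpq.pos
          field_simp at h4 ⊢
          linarith
  have h0 : ∀ x, |testFun i c x| ≤ C * c i ^ (-(5 / 2) : ℝ) * K x := fun x => by
    have := h i c hc0 x
    rwa [Real.rpow_zero, one_mul, zero_div, zero_sub] at this
  calc ∫⁻ x, w x * ENNReal.ofReal |testFun i c x|
      ≤ ∫⁻ x, ENNReal.ofReal (C * c i ^ (-(5 / 2) : ℝ)) * (w x * ENNReal.ofReal (K x)) := by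
        refine lintegral_mono fun x => ?_
        rw [mul_left_comm, ← ENNReal.ofReal_mul (by positivity)]
        gcongr
        exact h0 x
    _ = ENNReal.ofReal (C * c i ^ (-(5 / 2) : ℝ)) * ∫⁻ x, w x * ENNReal.ofReal (K x) :=
        lintegral_const_mul' _ _ ENNReal.ofReal_ne_top
    _ ≤ ENNReal.ofReal (C * c i ^ (-(5 / 2) : ℝ)) * ((∫⁻ x, w x ^ p) ^ (1 / p) *
        ENNReal.ofReal (c i ^ (-(1 / (2 * p))))) := by
        gcongr
        refine (ENNReal.lintegral_mul_le_Lp_mul_Lq volume hpq hw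
          (continuous_gaussProd _).measurable.ennreal_ofReal.aemeasurable).trans ?_
        gcongr
    _ = _ := by
        rw [mul_left_comm, ← ENNReal.ofReal_mul (by positivity), mul_assoc, ← Real.rpow_add hi,
          sub_eq_add_neg]

/-! ### The singular pairing in one variable -/

/-- The power of `a` is forced by scaling; the point is the sign. Gaussian moments reduce the
coefficient to `(α + 5)(α + 3) - 10(α + 3) + 15 = -α(2 - α)`. It vanishes at `α = 0` and `α = 2`,
where `|y| ^ α * y` is a polynomial of degree below five, and is negative in between. -/
theorem exists_integral_rpow_mul_hermFactor {α : ℝ} (hα₀ : 0 < α) (hα₂ : α < 2) :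
    ∃ K : ℝ, 0 < K ∧ ∀ a : ℝ, 0 < a →
      ∫ y : ℝ, |y| ^ α * y * (hermFactor a y * gauss a y) = -K * a ^ (α / 2 - 2) := by
  refine ⟨α * (2 - α) * Real.Gamma ((α + 3) / 2) * 4 ^ ((α + 3) / 2) / (8 * √(4 * Real.pi)),
    ?_, fun a ha => ?_⟩
  · have := Real.Gamma_pos_of_pos (by linarith : 0 < (α + 3) / 2)
    have := sub_pos.2 hα₂
    positivity
  set b := 1 / (4 * a) with hb
  have hb0 : 0 < b := by positivity
  have hbi : b⁻¹ = 4 * a := by rw [hb, one_div, inv_inv]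
  have hint : ∀ q : ℝ, -1 < q → IntegrableOn (fun y : ℝ => y ^ q * Real.exp (-b * y ^ 2)) (Ioi 0) :=
    fun q hq => by
      simpa using integrableOn_rpow_mul_exp_neg_mul_sq hb0 hq
  have hI : ∀ q : ℝ, -1 < q → ∫ y in Ioi (0 : ℝ), y ^ q * Real.exp (-b * y ^ 2) =
      b ^ (-(q + 1) / 2) * (1 / 2) * Real.Gamma ((q + 1) / 2) := fun q hq => by
    have := integral_rpow_mul_exp_neg_mul_rpow (p := 2) (by norm_num) hq hb0
    simpa using this
  set G := Real.Gamma ((α + 3) / 2) with hG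
  have hG1 : Real.Gamma ((α + 4 + 1) / 2) = (α + 3) / 2 * G := by
    rw [hG, ← Real.Gamma_add_one (by positivity)]; congr 1; ring
  have hG2 : Real.Gamma ((α + 6 + 1) / 2) = (α + 5) / 2 * ((α + 3) / 2 * G) := by
    rw [← hG1, show (α + 4 + 1) / 2 = (α + 5) / 2 by ring,
      ← Real.Gamma_add_one (by positivity)]
    congr 1; ring
  set I := b ^ (-(α + 2 + 1) / 2) with hIdef
  have hb1 : b ^ (-(α + 4 + 1) / 2) = I * (4 * a) := by
    rw [show -(α + 4 + 1) / 2 = -(α + 2 + 1) / 2 + -1 by ring, Real.rpow_add hb0,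
      Real.rpow_neg_one, hbi]
  have hb2 : b ^ (-(α + 6 + 1) / 2) = I * (4 * a) ^ 2 := by
    rw [show -(α + 6 + 1) / 2 = -(α + 4 + 1) / 2 + -1 by ring, Real.rpow_add hb0, hb1,
      Real.rpow_neg_one, hbi]
    ring
  have h1 : ∀ y : ℝ, |y| ^ α * y * (hermFactor a y * gauss a y) =
      (fun r : ℝ => r ^ α * r * (hermFactor a r * gauss a r)) |y| := by
    intro y
    rcases abs_cases y with ⟨h, _⟩ | ⟨h, _⟩
    · simp [h]
    · simp only [h, gauss_neg]
      simp only [hermFactor]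
      ring
  simp_rw [h1]
  rw [integral_comp_abs (f := fun r : ℝ => r ^ α * r * (hermFactor a r * gauss a r))]
  have h2 : ∀ y ∈ Ioi (0 : ℝ), y ^ α * y * (hermFactor a y * gauss a y) =
      (√(4 * Real.pi * a))⁻¹ * (1 / (2 * a) ^ 5 * (y ^ (α + 6) * Real.exp (-b * y ^ 2)) -
        10 / (2 * a) ^ 4 * (y ^ (α + 4) * Real.exp (-b * y ^ 2)) +
        15 / (2 * a) ^ 3 * (y ^ (α + 2) * Real.exp (-b * y ^ 2))) := by
    intro y hy
    have hy0 : (0 : ℝ) < y := hy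
    have e : ∀ k : ℕ, y ^ (α + (k : ℝ)) = y ^ α * y ^ k := fun k => by
      rw [Real.rpow_add hy0, Real.rpow_natCast]
    have e6 := e 6
    have e4 := e 4
    have e2 := e 2
    push_cast at e6 e4 e2
    rw [e6, e4, e2, gauss, hermFactor, show -(y ^ 2 / (4 * a)) = -b * y ^ 2 by rw [hb]; ring]
    ring
  rw [setIntegral_congr_fun measurableSet_Ioi h2, integral_const_mul, integral_add, integral_sub,
    integral_const_mul, integral_const_mul, integral_const_mul, hI _ (by linarith),
    hI _ (by linarith), hI _ (by linarith), hG1, hG2, hb1, hb2,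
    ← hIdef, show (α + 2 + 1) / 2 = (α + 3) / 2 by ring, ← hG]
  · have h3 : I = 4 ^ ((α + 3) / 2) * a ^ (α / 2 - 2) * (a ^ 3 * √a) := by
      rw [hIdef, hb, one_div, Real.inv_rpow (by positivity), ← Real.rpow_neg (by positivity),
        Real.mul_rpow (by norm_num) ha.le, mul_assoc, Real.sqrt_eq_rpow, ← Real.rpow_natCast,
        ← Real.rpow_add ha, ← Real.rpow_add ha]
      congr 2 <;> [ring; (push_cast; ring)]
    rw [h3, Real.sqrt_mul (by positivity)]
    have : 0 < √a := Real.sqrt_pos.2 ha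
    have : 0 < √(4 * Real.pi) := by positivity
    field_simp
    ring
  · exact (hint _ (by linarith)).const_mul _
  · exact (hint _ (by linarith)).const_mul _
  · exact ((hint _ (by linarith)).const_mul _).sub ((hint _ (by linarith)).const_mul _)
  · exact (hint _ (by linarith)).const_mul _

/-! ### The heat semigroup on `C₀` -/

theorem norm_apply_le (v : C₀(𝔼, ℂ)) (x : 𝔼) : ‖v x‖ ≤ ‖v‖ := v.toBCF.norm_coe_le_norm x

theorem norm_le_of_forall {v : C₀(𝔼, ℂ)} {C : ℝ} (hC : 0 ≤ C) (h : ∀ x, ‖v x‖ ≤ C) : ‖v‖ ≤ C :=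
  (BoundedContinuousFunction.norm_le hC).2 h

/-- Evaluation at a point. -/
def evalCLM (x : 𝔼) : C₀(𝔼, ℂ) →L[ℂ] ℂ :=
  LinearMap.mkContinuous ⟨⟨fun v => v x, fun _ _ => rfl⟩, fun _ _ => rfl⟩ 1
    fun v => by simpa using norm_apply_le v x

@[simp]
theorem evalCLM_apply (x : 𝔼) (v : C₀(𝔼, ℂ)) : evalCLM x v = v x := rfl

theorem integrable_smul_apply {g : 𝔼 → ℝ} (hg : Integrable g) (v : C₀(𝔼, ℂ)) :
    Integrable fun x => g x • v x := by
  have := hg.ofReal (𝕜 := ℂ)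
  refine (this.mul_bdd (c := ‖v‖) v.continuous.aestronglyMeasurable
    (Eventually.of_forall (norm_apply_le v))).congr (Eventually.of_forall fun x => ?_)
  simp

/-- Integration against an integrable function. -/
def pairCLM (g : 𝔼 → ℝ) (hg : Integrable g) : C₀(𝔼, ℂ) →L[ℂ] ℂ :=
  LinearMap.mkContinuous
    ⟨⟨fun v => ∫ x, g x • v x, fun v w => by
      rw [← integral_add (integrable_smul_apply hg v) (integrable_smul_apply hg w)]
      simp⟩, fun c v => by
      rw [RingHom.id_apply, ← integral_smul]
      simp only [ZeroAtInftyContinuousMap.smul_apply, smul_comm c]⟩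
    (∫ x, ‖g x‖) fun v => by
      rw [mul_comm, ← integral_const_mul]
      refine norm_integral_le_of_norm_le (hg.norm.const_mul _) (Eventually.of_forall fun x => ?_)
      rw [norm_smul, mul_comm]
      gcongr
      exact norm_apply_le v x

theorem pairCLM_apply {g : 𝔼 → ℝ} (hg : Integrable g) (v : C₀(𝔼, ℂ)) :
    pairCLM g hg v = ∫ x, g x • v x := rfl

/-- The translate `x ↦ v (x - h)`. -/
def translate (h : 𝔼) (v : C₀(𝔼, ℂ)) : C₀(𝔼, ℂ) :=
  v.comp ⟨⟨fun x => x - h, by fun_prop⟩, (Homeomorph.subRight h).isClosedEmbedding.tendsto_cocompact⟩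

@[simp]
theorem translate_apply (h : 𝔼) (v : C₀(𝔼, ℂ)) (x : 𝔼) : translate h v x = v (x - h) := rfl

theorem translate_sub (h : 𝔼) (v w : C₀(𝔼, ℂ)) :
    translate h (v - w) = translate h v - translate h w := rfl

theorem norm_translate_le (h : 𝔼) (v : C₀(𝔼, ℂ)) : ‖translate h v‖ ≤ ‖v‖ :=
  norm_le_of_forall (norm_nonneg v) fun x => norm_apply_le v (x - h)

/-- Translations are 1-Lipschitz in `v` uniformly in `h`, so continuity in `h` for fixed `v`
suffices, and that is uniform continuity of `v`. -/
theorem continuous_translate : Continuous fun q : 𝔼 × C₀(𝔼, ℂ) => translate q.1 q.2 := by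
  refine continuous_prod_of_continuous_lipschitzWith' _ 1 (fun h => ?_) fun v => ?_
  · refine LipschitzWith.of_dist_le_mul fun v w => ?_
    rw [dist_eq_norm, dist_eq_norm, ← translate_sub, NNReal.coe_one, one_mul]
    exact norm_translate_le h _
  · refine Metric.continuous_iff.2 fun h ε hε => ?_
    obtain ⟨δ, hδ, H⟩ := Metric.uniformContinuous_iff.1
      (ZeroAtInftyContinuousMap.uniformContinuous v) (ε / 2) (half_pos hε)
    refine ⟨δ, hδ, fun h' hh => ?_⟩
    rw [dist_eq_norm]
    refine lt_of_le_of_lt (norm_le_of_forall (half_pos hε).le fun x => ?_) (half_lt_self hε)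
    rw [ZeroAtInftyContinuousMap.sub_apply, translate_apply, translate_apply, ← dist_eq_norm]
    refine (H ?_).le
    rwa [dist_sub_left]

/-- The heat semigroup on `C₀`, as an average of translations. -/
def heatOp (t : ℝ) (v : C₀(𝔼, ℂ)) : C₀(𝔼, ℂ) :=
  ∫ z : 𝔼, gaussProd (fun _ => 1) z • translate (√t • z) v

theorem integrable_heatOp (t : ℝ) (v : C₀(𝔼, ℂ)) :
    Integrable fun z : 𝔼 => gaussProd (fun _ => 1) z • translate (√t • z) v := by
  have hc : Continuous fun z : 𝔼 => gaussProd (fun _ => 1) z • translate (√t • z) v := by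
    refine (continuous_gaussProd _).smul ?_
    exact continuous_translate.comp (by fun_prop : Continuous fun z : 𝔼 => (√t • z, v))
  refine ((integrable_gaussProd (fun _ => one_pos)).mul_const ‖v‖).mono' hc.aestronglyMeasurable
    (Eventually.of_forall fun z => ?_)
  rw [norm_smul, Real.norm_of_nonneg (gaussProd_nonneg _ _)]
  gcongr
  · exact gaussProd_nonneg _ _
  · exact norm_translate_le _ v

theorem heatOp_apply (t : ℝ) (v : C₀(𝔼, ℂ)) (x : 𝔼) :
    heatOp t v x = ∫ z : 𝔼, gaussProd (fun _ => 1) z • v (x - √t • z) := by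
  rw [← evalCLM_apply, heatOp, ← ContinuousLinearMap.integral_comp_comm _ (integrable_heatOp t v)]
  rfl

theorem heatOp_sub (t : ℝ) (v w : C₀(𝔼, ℂ)) : heatOp t (v - w) = heatOp t v - heatOp t w := by
  rw [heatOp, heatOp, heatOp, ← integral_sub (integrable_heatOp t v) (integrable_heatOp t w)]
  refine integral_congr_ae (Eventually.of_forall fun z => ?_)
  ext x
  exact smul_sub (gaussProd (fun _ => 1) z) (v (x - √t • z)) (w (x - √t • z))

theorem norm_heatOp_le (t : ℝ) (v : C₀(𝔼, ℂ)) : ‖heatOp t v‖ ≤ ‖v‖ := by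
  have h1 : ∀ _ : Fin N, (0 : ℝ) < 1 := fun _ => one_pos
  refine (norm_integral_le_of_norm_le ((integrable_gaussProd h1).mul_const ‖v‖)
    (Eventually.of_forall fun z => ?_)).trans ?_
  · rw [norm_smul, Real.norm_of_nonneg (gaussProd_nonneg _ _)]
    gcongr
    · exact gaussProd_nonneg _ _
    · exact norm_translate_le _ v
  · rw [integral_mul_const, integral_gaussProd h1, one_mul]

/-- Contractivity uniform in `t` reduces the claim to strong continuity, by dominated convergence.
It holds on the whole real line: `√t = 0` for `t ≤ 0`, where the operator is the identity. -/
theorem continuous_heatOp : Continuous fun q : ℝ × C₀(𝔼, ℂ) => heatOp q.1 q.2 := by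
  refine continuous_prod_of_continuous_lipschitzWith' _ 1 (fun t => ?_) fun v => ?_
  · refine LipschitzWith.of_dist_le_mul fun v w => ?_
    rw [dist_eq_norm, dist_eq_norm, ← heatOp_sub, NNReal.coe_one, one_mul]
    exact norm_heatOp_le t _
  · refine continuous_of_dominated (bound := fun z : 𝔼 => gaussProd (fun _ => 1) z * ‖v‖)
      (fun t => (integrable_heatOp t v).aestronglyMeasurable) (fun t => ?_)
      ((integrable_gaussProd (fun _ => one_pos)).mul_const ‖v‖) ?_
    · refine Eventually.of_forall fun z => ?_
      rw [norm_smul, Real.norm_of_nonneg (gaussProd_nonneg _ _)]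
      gcongr
      · exact gaussProd_nonneg _ _
      · exact norm_translate_le _ v
    · refine Eventually.of_forall fun z => ?_
      have h : Continuous fun t : ℝ => translate (√t • z) v :=
        continuous_translate.comp (by fun_prop : Continuous fun t : ℝ => (√t • z, v))
      exact h.const_smul (gaussProd (fun _ => 1) z)

theorem heatSemigroup_eq {t : ℝ} (ht : 0 < t) (f : 𝔼 → ℂ) (x : 𝔼) :
    heatSemigroup t f x = ∫ y, gaussProd (fun _ => t) (x - y) • f y := by
  simp only [heatSemigroup, if_pos ht, heatKernel_eq_gaussProd ht]

theorem gaussProd_sqrt_smul {t : ℝ} (ht : 0 < t) (z : 𝔼) :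
    gaussProd (fun _ => 1) z = √t ^ N * gaussProd (fun _ => t) (√t • z) := by
  have h : ∀ i : Fin N, gauss 1 (z i) = √t * gauss t ((√t • z) i) := by
    intro i
    have : 0 < √t := Real.sqrt_pos.2 ht
    rw [gauss, gauss, PiLp.smul_apply, smul_eq_mul, mul_pow, Real.sq_sqrt ht.le,
      Real.sqrt_mul (by positivity) t, mul_one]
    have : t * z i ^ 2 / (4 * t) = z i ^ 2 / (4 * 1) := by field_simp
    rw [this]
    field_simp
  simp only [gaussProd, h, Finset.prod_mul_distrib, Finset.prod_const, Finset.card_univ,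
    Fintype.card_fin]

/-- Substitute `y = x - √t • z` in the convolution; for `t ≤ 0` both sides are `v x`. -/
theorem heatSemigroup_eq_heatOp (t : ℝ) (v : C₀(𝔼, ℂ)) (x : 𝔼) :
    heatSemigroup t v x = heatOp t v x := by
  rw [heatOp_apply]
  rcases lt_or_ge 0 t with ht | ht
  · have hs : 0 < √t := Real.sqrt_pos.2 ht
    rw [heatSemigroup_eq ht, ← integral_sub_left_eq_self _ volume x]
    have h := Measure.integral_comp_smul (volume : Measure 𝔼)
      (fun w => gaussProd (fun _ => t) w • v (x - w)) (√t)
    simp only [finrank_euclideanSpace, Fintype.card_fin] at h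
    simp only [sub_sub_cancel, gaussProd_sqrt_smul ht, mul_smul]
    rw [integral_smul, h, abs_of_pos (by positivity), smul_inv_smul₀ (by positivity)]
  · simp only [Real.sqrt_eq_zero_of_nonpos ht, zero_smul, sub_zero]
    rw [integral_smul_const, integral_gaussProd (fun _ => one_pos), one_smul, heatSemigroup,
      if_neg ht.not_gt]

/-- Evenness of the heat kernel makes the semigroup self-adjoint, so Fubini moves it onto the test
function, where it only adds `τ` to every width. -/
theorem integral_testFun_smul_heatOp (i : Fin N) {c : Fin N → ℝ} (hc : ∀ j, 0 < c j) {τ : ℝ}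
    (hτ : 0 ≤ τ) (v : C₀(𝔼, ℂ)) :
    ∫ x, testFun i c x • heatOp τ v x = ∫ x, testFun i (fun j => c j + τ) x • v x := by
  rcases hτ.eq_or_lt with rfl | hτ
  · simp only [add_zero, ← heatSemigroup_eq_heatOp, heatSemigroup, lt_irrefl, if_false]
  have hK : ∀ _ : Fin N, 0 < τ := fun _ => hτ
  simp only [← heatSemigroup_eq_heatOp, heatSemigroup_eq hτ, ← integral_smul]
  rw [integral_integral_swap]
  · refine integral_congr_ae (Eventually.of_forall fun y => ?_)
    simp only [smul_smul]
    rw [integral_smul_const, ← integral_gaussProd_mul_testFun i hτ hc]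
    congr 2
    ext x
    rw [← neg_sub, gaussProd_neg, mul_comm]
  · have h1 : Integrable (fun q : 𝔼 × 𝔼 => testFun i c q.1 * gaussProd (fun _ => τ) (q.1 - q.2))
        (volume.prod volume) := by
      have := Integrable.convolution_integrand (ContinuousLinearMap.mul ℝ ℝ) (μ := volume)
        (integrable_testFun i hc) (integrable_gaussProd hK)
      have := this.swap
      refine this.congr (Eventually.of_forall fun q => ?_)
      simp only [Function.comp_def, Prod.fst_swap, Prod.snd_swap, ContinuousLinearMap.mul_apply']
      rw [← neg_sub, gaussProd_neg]
    have h2 := (h1.ofReal (𝕜 := ℂ)).mul_bdd (c := ‖v‖)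
      (by fun_prop : Continuous fun q : 𝔼 × 𝔼 => v q.2).aestronglyMeasurable
      (Eventually.of_forall fun q => norm_apply_le v q.2)
    refine h2.congr (Eventually.of_forall fun q => ?_)
    simp [Function.uncurry, mul_assoc]

/-! ### Abstract mild solutions: uniqueness and local existence -/

section MildSolutions

variable {X : Type*} [NormedAddCommGroup X] {S : ℝ → X → X} {F : X → X}
  {L : ℝ → ℝ}

/-- A strongly continuous contractive family `S` and a locally Lipschitz map `F` with `F 0 = 0`. -/
structure IsMildPair (S : ℝ → X → X) (F : X → X) (L : ℝ → ℝ) : Prop where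
  continuous_semigroup : Continuous fun q : ℝ × X => S q.1 q.2
  norm_semigroup_sub_le : ∀ t v w, ‖S t v - S t w‖ ≤ ‖v - w‖
  norm_semigroup_le : ∀ t v, ‖S t v‖ ≤ ‖v‖
  continuous_nonlinearity : Continuous F
  nonlinearity_zero : F 0 = 0
  lip_nonneg : ∀ R, 0 ≤ R → 0 ≤ L R
  norm_nonlinearity_sub_le : ∀ R v w, ‖v‖ ≤ R → ‖w‖ ≤ R → ‖F v - F w‖ ≤ L R * ‖v - w‖

theorem IsMildPair.norm_nonlinearity_le (h : IsMildPair S F L) {R : ℝ} {v : X} (hv : ‖v‖ ≤ R) :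
    ‖F v‖ ≤ L R * R := by
  have hR := (norm_nonneg v).trans hv
  have h1 := h.norm_nonlinearity_sub_le R v 0 hv (by simpa using hR)
  rw [h.nonlinearity_zero, sub_zero, sub_zero] at h1
  exact h1.trans (mul_le_mul_of_nonneg_left hv (h.lip_nonneg R hR))

theorem continuous_mildIntegrand (h : IsMildPair S F L) {u : ℝ → X} (hu : Continuous u) :
    Continuous fun q : ℝ × ℝ => S (q.1 - q.2) (F (u q.2)) := by
  have h' : Continuous fun q : ℝ × ℝ => (q.1 - q.2, F (u q.2)) :=
    (continuous_fst.sub continuous_snd).prodMk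
      (h.continuous_nonlinearity.comp (hu.comp continuous_snd))
  exact h.continuous_semigroup.comp h'

theorem continuousOn_mildIntegrand (h : IsMildPair S F L) {u : ℝ → X} (t : ℝ) {s : Set ℝ}
    (hu : ContinuousOn u s) :
    ContinuousOn (fun r : ℝ => S (t - r) (F (u r))) s := by
  have h' : ContinuousOn (fun r : ℝ => (t - r, F (u r))) s :=
    (continuous_const.sub continuous_id).continuousOn.prodMk
      (h.continuous_nonlinearity.comp_continuousOn hu)
  exact h.continuous_semigroup.comp_continuousOn h'

theorem intervalIntegrable_mildIntegrand (h : IsMildPair S F L) {u : ℝ → X} {t : ℝ}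
    (ht : 0 ≤ t) (hu : ContinuousOn u (Icc 0 t)) :
    IntervalIntegrable (fun r : ℝ => S (t - r) (F (u r))) volume 0 t :=
  (continuousOn_mildIntegrand h t (by rwa [uIcc_of_le ht])).intervalIntegrable

variable [NormedSpace ℂ X]

/-- The right-hand side of Duhamel's formula. -/
def mildMap (S : ℝ → X → X) (F : X → X) (lam : ℂ) (φ : X) (u : ℝ → X) (t : ℝ) : X :=
  S t φ + lam • ∫ s in (0 : ℝ)..t, S (t - s) (F (u s))

theorem norm_mildMap_sub_le (h : IsMildPair S F L) (lam : ℂ) (φ : X) {u v : ℝ → X}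
    {t R : ℝ} (ht : 0 ≤ t) (hu : ContinuousOn u (Icc 0 t)) (hv : ContinuousOn v (Icc 0 t))
    (huR : ∀ s ∈ Icc 0 t, ‖u s‖ ≤ R) (hvR : ∀ s ∈ Icc 0 t, ‖v s‖ ≤ R) :
    ‖mildMap S F lam φ u t - mildMap S F lam φ v t‖ ≤
      ‖lam‖ * (L R) * ∫ s in (0 : ℝ)..t, ‖u s - v s‖ := by
  rw [mildMap, mildMap, add_sub_add_left_eq_sub, ← smul_sub,
    ← intervalIntegral.integral_sub (intervalIntegrable_mildIntegrand h ht hu)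
      (intervalIntegrable_mildIntegrand h ht hv), norm_smul, mul_assoc]
  gcongr
  rw [← intervalIntegral.integral_const_mul]
  refine intervalIntegral.norm_integral_le_of_norm_le ht (Eventually.of_forall fun s hs => ?_) ?_
  · have hs' : s ∈ Icc 0 t := ⟨hs.1.le, hs.2⟩
    exact (h.norm_semigroup_sub_le _ _ _).trans
      (h.norm_nonlinearity_sub_le R _ _ (huR s hs') (hvR s hs'))
  · refine ContinuousOn.intervalIntegrable ?_
    rw [uIcc_of_le ht]
    exact continuousOn_const.mul (hu.sub hv).norm

/-- Gronwall through a weighted norm: at a maximum point `m` of `exp (-μ t) ‖u t - v t‖`, with value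
`W`, the integral inequality gives `W ≤ (B / μ) W`, and `μ = 2B + 1` forces `W = 0`. -/
theorem eqOn_of_mildMap (h : IsMildPair S F L) (lam : ℂ) (φ : X) {u v : ℝ → X}
    {b : ℝ} (hb : 0 ≤ b) (hu : ContinuousOn u (Icc 0 b)) (hv : ContinuousOn v (Icc 0 b))
    (hu' : ∀ t ∈ Icc 0 b, u t = mildMap S F lam φ u t)
    (hv' : ∀ t ∈ Icc 0 b, v t = mildMap S F lam φ v t) : EqOn u v (Icc 0 b) := by
  obtain ⟨R₁, hR₁⟩ := isCompact_Icc.exists_bound_of_continuousOn hu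
  obtain ⟨R₂, hR₂⟩ := isCompact_Icc.exists_bound_of_continuousOn hv
  set R := max R₁ R₂
  have hR : 0 ≤ R := (norm_nonneg _).trans ((hR₁ 0 ⟨le_rfl, hb⟩).trans (le_max_left _ _))
  set B := ‖lam‖ * (L R) with hB
  have hB0 : 0 ≤ B := mul_nonneg (norm_nonneg _) (h.lip_nonneg R hR)
  set μ := 2 * B + 1 with hμ
  have hμ0 : 0 < μ := by positivity
  have hw : ∀ t ∈ Icc 0 b, ‖u t - v t‖ ≤ B * ∫ s in (0 : ℝ)..t, ‖u s - v s‖ := fun t ht => by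
    have hsub : Icc 0 t ⊆ Icc 0 b := Icc_subset_Icc_right ht.2
    conv_lhs => rw [hu' t ht, hv' t ht]
    exact norm_mildMap_sub_le h lam φ ht.1 (hu.mono hsub) (hv.mono hsub)
      (fun s hs => (hR₁ s (hsub hs)).trans (le_max_left _ _))
      (fun s hs => (hR₂ s (hsub hs)).trans (le_max_right _ _))
  obtain ⟨m, hm, hmax⟩ := isCompact_Icc.exists_isMaxOn (nonempty_Icc.2 hb)
    ((Real.continuous_exp.comp (continuous_const.mul continuous_id : Continuous fun t : ℝ => -μ * t)
      ).continuousOn.mul (hu.sub hv).norm)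
  set W := Real.exp (-μ * m) * ‖u m - v m‖ with hS
  have hS0 : 0 ≤ W := by positivity
  have hwS : ∀ s ∈ Icc 0 b, ‖u s - v s‖ ≤ W * Real.exp (μ * s) := fun s hs => by
    have h1 : Real.exp (-μ * s) * ‖u s - v s‖ ≤ W := hmax hs
    have h2 : Real.exp (-μ * s) * Real.exp (μ * s) = 1 := by rw [← Real.exp_add]; simp
    calc ‖u s - v s‖ = (Real.exp (-μ * s) * ‖u s - v s‖) * Real.exp (μ * s) := by
          rw [mul_right_comm, h2, one_mul]
      _ ≤ _ := by gcongr
  have hint : ∫ s in (0 : ℝ)..m, ‖u s - v s‖ ≤ W * (Real.exp (μ * m) / μ) := by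
    have hsub : Icc 0 m ⊆ Icc 0 b := Icc_subset_Icc_right hm.2
    calc ∫ s in (0 : ℝ)..m, ‖u s - v s‖ ≤ ∫ s in (0 : ℝ)..m, W * Real.exp (μ * s) := by
          refine intervalIntegral.integral_mono_on hm.1 ?_ ?_ fun s hs => hwS s (hsub hs)
          · refine ContinuousOn.intervalIntegrable ?_
            rw [uIcc_of_le hm.1]
            exact ((hu.sub hv).norm).mono hsub
          · exact (by fun_prop : Continuous fun s => W * Real.exp (μ * s)).intervalIntegrable _ _
      _ = W * ((Real.exp (μ * m) - 1) / μ) := by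
          rw [intervalIntegral.integral_const_mul,
            intervalIntegral.integral_comp_mul_left (fun s => Real.exp s) hμ0.ne', integral_exp]
          simp [div_eq_inv_mul]
      _ ≤ _ := by gcongr; linarith
  have hS1 : W ≤ B / μ * W := by
    have h1 := (hw m hm).trans (mul_le_mul_of_nonneg_left hint hB0)
    have h2 : Real.exp (-μ * m) * Real.exp (μ * m) = 1 := by rw [← Real.exp_add]; simp
    calc W ≤ Real.exp (-μ * m) * (B * (W * (Real.exp (μ * m) / μ))) := by rw [hS]; gcongr
      _ = (Real.exp (-μ * m) * Real.exp (μ * m)) * (B / μ * W) := by ring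
      _ = _ := by rw [h2, one_mul]
  have hS2 : W = 0 := by
    have : B / μ ≤ 1 / 2 := by rw [div_le_iff₀ hμ0]; linarith
    nlinarith
  intro t ht
  have h1 := hwS t ht
  rw [hS2, zero_mul] at h1
  exact sub_eq_zero.1 (norm_le_zero_iff.1 h1)

/-- Banach's fixed point theorem for the Duhamel map on the closed ball of radius `‖φ‖ + 1` in
`C([0, τ], X)`. -/
theorem exists_local_solution [CompleteSpace X] (h : IsMildPair S F L) (lam : ℂ) (φ : X) :
    ∃ τ : ℝ, 0 < τ ∧ ∃ u : ℝ → X, Continuous u ∧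
      ∀ t ∈ Icc 0 τ, u t = mildMap S F lam φ u t := by
  set R := ‖φ‖ + 1 with hR
  -- Since `1 ≤ R`, the single constant `M` controls both the self-mapping property and the
  -- Lipschitz constant.
  have hR1 : 1 ≤ R := by rw [hR]; linarith [norm_nonneg φ]
  set M := ‖lam‖ * (L R) * R with hM
  have hL0 : 0 ≤ L R := h.lip_nonneg R (by linarith)
  have hM0 : 0 ≤ M := by positivity
  set τ := 1 / (2 * (M + 1)) with hτ
  have hτ0 : 0 < τ := by positivity
  have hτM : τ * M ≤ 1 / 2 := by
    rw [hτ, one_div_mul_eq_div, div_le_iff₀ (by positivity)]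
    linarith
  -- Constant extension beyond the endpoints makes the Duhamel integrand continuous on the whole
  -- plane.
  let ext : C(Icc (0 : ℝ) τ, X) → ℝ → X := fun w => IccExtend hτ0.le w
  have hext : ∀ w, Continuous (ext w) := fun w => w.continuous.Icc_extend'
  have hextR : ∀ (w : C(Icc (0 : ℝ) τ, X)) (s : ℝ), ‖ext w s‖ ≤ ‖w‖ :=
    fun w s => w.norm_coe_le_norm _
  let Φ : C(Icc (0 : ℝ) τ, X) → C(Icc (0 : ℝ) τ, X) := fun w =>
    ⟨fun t => mildMap S F lam φ (ext w) t, by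
      have h1 : Continuous fun t : ℝ => S t φ :=
        h.continuous_semigroup.comp (by fun_prop : Continuous fun t : ℝ => (t, φ))
      have h2 := intervalIntegral.continuous_parametric_intervalIntegral_of_continuous
        (μ := volume) (a₀ := 0) (f := fun t s => S (t - s) (F (ext w s)))
        (continuous_mildIntegrand h (hext w)) continuous_id
      exact (h1.add (h2.const_smul lam)).comp continuous_subtype_val⟩
  let K : Set C(Icc (0 : ℝ) τ, X) := Metric.closedBall 0 R
  have hK : ∀ {w}, w ∈ K ↔ ‖w‖ ≤ R := fun {w} => by
    rw [Metric.mem_closedBall, dist_zero_right]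
  have hmaps : MapsTo Φ K K := by
    intro w hw
    rw [hK] at hw ⊢
    refine (ContinuousMap.norm_le _ (by linarith)).2 fun t => ?_
    have h1 : ‖∫ s in (0 : ℝ)..t, S (t - s) (F (ext w s))‖ ≤
        L R * R * |(t : ℝ) - 0| :=
      intervalIntegral.norm_integral_le_of_norm_le_const fun s _ =>
        (h.norm_semigroup_le _ _).trans (h.norm_nonlinearity_le ((hextR w s).trans hw))
    rw [sub_zero, abs_of_nonneg t.2.1] at h1
    calc ‖mildMap S F lam φ (ext w) t‖ ≤ ‖φ‖ + ‖lam‖ * (L R * R * t) := by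
          refine (norm_add_le _ _).trans (add_le_add (h.norm_semigroup_le _ _) ?_)
          rw [norm_smul]
          gcongr
      _ ≤ ‖φ‖ + τ * M := by
          have h2 : ‖lam‖ * (L R * R * t) ≤ ‖lam‖ * (L R * R * τ) := by
            gcongr
            exact t.2.2
          have h3 : ‖lam‖ * (L R * R * τ) = τ * M := by rw [hM]; ring
          linarith
      _ ≤ R := by rw [hR]; linarith
  have hlip : ContractingWith (1 / 2) (hmaps.restrict Φ K K) := by
    refine ⟨by rw [← NNReal.coe_lt_coe]; norm_num, LipschitzWith.of_dist_le_mul fun w v => ?_⟩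
    have hw := hK.1 w.2
    have hv := hK.1 v.2
    rw [Subtype.dist_eq, Subtype.dist_eq, MapsTo.val_restrict_apply, MapsTo.val_restrict_apply]
    refine (ContinuousMap.dist_le (by positivity)).2 fun t => ?_
    rw [dist_eq_norm]
    refine (norm_mildMap_sub_le h lam φ t.2.1 (hext w).continuousOn (hext v).continuousOn
      (fun s _ => (hextR w s).trans hw) (fun s _ => (hextR v s).trans hv)).trans ?_
    have h1 : ∫ s in (0 : ℝ)..t, ‖ext w s - ext v s‖ ≤ t * dist w.1 v.1 := by
      have h2 : ∀ s ∈ Icc (0 : ℝ) t, ‖ext w s - ext v s‖ ≤ dist w.1 v.1 := fun s _ => by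
        rw [← dist_eq_norm]
        exact ContinuousMap.dist_apply_le_dist _
      refine (intervalIntegral.integral_mono_on t.2.1
        (((hext w).sub (hext v)).norm.intervalIntegrable _ _)
        intervalIntegrable_const h2).trans (le_of_eq ?_)
      simp
    calc _ ≤ ‖lam‖ * (L R) * (τ * dist w.1 v.1) := by
          gcongr
          refine h1.trans ?_
          gcongr
          exact t.2.2
      _ = (τ * (‖lam‖ * (L R) * 1)) * dist w.1 v.1 := by ring
      _ ≤ (τ * M) * dist w.1 v.1 := by
          rw [hM]
          gcongr
      _ ≤ 1 / 2 * dist w.1 v.1 := by gcongr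
      _ = _ := by norm_num
  obtain ⟨w, -, hw, -⟩ := hlip.exists_fixedPoint' Metric.isClosed_closedBall.isComplete hmaps
    (x := 0) (hK.2 (by simp; linarith)) (edist_ne_top _ _)
  refine ⟨τ, hτ0, ext w, hext w, fun t ht => ?_⟩
  have h1 := congrArg (fun f : C(Icc (0 : ℝ) τ, X) => f ⟨t, ht⟩) hw
  rw [show ext w t = w ⟨t, ht⟩ from IccExtend_of_mem hτ0.le w ht]
  exact h1.symm

end MildSolutions

/-! ### The power nonlinearity and the maximal solution -/

theorem powerNonlinearity_neg (α : ℝ) (z : ℂ) :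
    powerNonlinearity α (-z) = -powerNonlinearity α z := by
  simp [powerNonlinearity]

theorem continuous_powerNonlinearity {α : ℝ} (hα : 0 < α) : Continuous (powerNonlinearity α) := by
  unfold powerNonlinearity
  exact (Complex.continuous_ofReal.comp
    (continuous_norm.rpow_const fun _ => Or.inr hα.le)).mul continuous_id

/-- Bernoulli's inequality with exponent `1 + α` at the point `ρ / r`. -/
theorem sub_rpow_mul_le {α r ρ : ℝ} (hα : 0 < α) (hρ : 0 ≤ ρ) (h : ρ ≤ r) :
    (r ^ α - ρ ^ α) * ρ ≤ (1 + α) * r ^ α * (r - ρ) := by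
  rcases (hρ.trans h).eq_or_lt with hr | hr
  · have : ρ = 0 := le_antisymm (h.trans hr.symm.le) hρ
    simp [← hr, this]
  have h1 := one_add_mul_self_le_rpow_one_add (s := ρ / r - 1) (p := 1 + α)
    (by have : 0 ≤ ρ / r := by positivity
        linarith) (by linarith)
  rw [add_sub_cancel, Real.div_rpow hρ hr.le, Real.rpow_one_add' hρ (by linarith),
    Real.rpow_one_add' hr.le (by linarith), le_div_iff₀ (by positivity)] at h1
  have h2 : (1 + (1 + α) * (ρ / r - 1)) * (r * r ^ α) =
      r * r ^ α - (1 + α) * r ^ α * (r - ρ) := by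
    field_simp
    ring
  have h3 : 0 ≤ r ^ α := by positivity
  nlinarith

/-- The factor `R ^ α` matters beyond local well-posedness: applied pointwise with `R = 2 * |x i|`,
it later yields an error of the same homogeneity as the singularity. -/
theorem norm_powerNonlinearity_sub_le {α : ℝ} (hα : 0 < α) {R : ℝ} {z w : ℂ} (hz : ‖z‖ ≤ R)
    (hw : ‖w‖ ≤ R) :
    ‖powerNonlinearity α z - powerNonlinearity α w‖ ≤ (2 + α) * R ^ α * ‖z - w‖ := by
  -- The difference of the powers is then multiplied by the smaller modulus, as the Bernoulli bound
  -- requires.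
  wlog h : ‖w‖ ≤ ‖z‖ generalizing z w
  · rw [norm_sub_rev, norm_sub_rev z]
    exact this hw hz (le_of_not_ge h)
  have h1 : powerNonlinearity α z - powerNonlinearity α w =
      ((‖z‖ ^ α : ℝ) : ℂ) * (z - w) + ((‖z‖ ^ α - ‖w‖ ^ α : ℝ) : ℂ) * w := by
    simp only [powerNonlinearity]
    push_cast
    ring
  have h0 : ‖w‖ ^ α ≤ ‖z‖ ^ α := by gcongr
  calc _ ≤ ‖z‖ ^ α * ‖z - w‖ + (‖z‖ ^ α - ‖w‖ ^ α) * ‖w‖ := by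
        rw [h1]
        refine (norm_add_le _ _).trans (le_of_eq ?_)
        rw [norm_mul, norm_mul, Complex.norm_real, Complex.norm_real,
          Real.norm_of_nonneg (by positivity), Real.norm_of_nonneg (sub_nonneg.2 h0)]
    _ ≤ ‖z‖ ^ α * ‖z - w‖ + (1 + α) * ‖z‖ ^ α * (‖z‖ - ‖w‖) := by
        exact add_le_add le_rfl (sub_rpow_mul_le hα (norm_nonneg w) h)
    _ ≤ ‖z‖ ^ α * ‖z - w‖ + (1 + α) * ‖z‖ ^ α * ‖z - w‖ := by
        gcongr
        exact norm_sub_norm_le z w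
    _ = (2 + α) * ‖z‖ ^ α * ‖z - w‖ := by ring
    _ ≤ _ := by gcongr

/-- The Nemytskii operator of the power nonlinearity on `C₀`. -/
def powerC₀ (α : ℝ) (hα : 0 < α) (v : C₀(𝔼, ℂ)) : C₀(𝔼, ℂ) where
  toFun x := powerNonlinearity α (v x)
  continuous_toFun := (continuous_powerNonlinearity hα).comp v.continuous
  zero_at_infty' := by
    have h := ((continuous_powerNonlinearity hα).tendsto 0).comp v.zero_at_infty'
    rwa [show powerNonlinearity α 0 = 0 by simp [powerNonlinearity]] at h

@[simp]
theorem powerC₀_apply {α : ℝ} (hα : 0 < α) (v : C₀(𝔼, ℂ)) (x : 𝔼) :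
    powerC₀ α hα v x = powerNonlinearity α (v x) := rfl

theorem norm_powerC₀_sub_le {α : ℝ} (hα : 0 < α) {R : ℝ} {v w : C₀(𝔼, ℂ)} (hv : ‖v‖ ≤ R)
    (hw : ‖w‖ ≤ R) : ‖powerC₀ α hα v - powerC₀ α hα w‖ ≤ (2 + α) * R ^ α * ‖v - w‖ := by
  have hR := (norm_nonneg v).trans hv
  refine norm_le_of_forall (by positivity) fun x => ?_
  refine (norm_powerNonlinearity_sub_le hα ((norm_apply_le v x).trans hv)
    ((norm_apply_le w x).trans hw)).trans ?_
  gcongr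
  exact norm_apply_le (v - w) x

theorem continuous_powerC₀ {α : ℝ} (hα : 0 < α) :
    Continuous (powerC₀ α hα : C₀(𝔼, ℂ) → C₀(𝔼, ℂ)) := by
  refine continuous_iff_continuousAt.2 fun v => ?_
  rw [ContinuousAt, tendsto_iff_norm_sub_tendsto_zero]
  have h : Tendsto (fun w : C₀(𝔼, ℂ) => (2 + α) * (‖v‖ + 1) ^ α * ‖w - v‖) (𝓝 v) (𝓝 0) := by
    have : Continuous fun w : C₀(𝔼, ℂ) => (2 + α) * (‖v‖ + 1) ^ α * ‖w - v‖ := by fun_prop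
    simpa using this.tendsto v
  refine squeeze_zero' (Eventually.of_forall fun w => norm_nonneg _) ?_ h
  filter_upwards [Metric.ball_mem_nhds v one_pos] with w hw
  rw [mem_ball_iff_norm] at hw
  refine norm_powerC₀_sub_le hα ?_ (by linarith)
  linarith [norm_le_norm_add_norm_sub' w v]

theorem isMildPair_heatOp {α : ℝ} (hα : 0 < α) :
    IsMildPair (heatOp (N := N)) (powerC₀ α hα) fun R => (2 + α) * R ^ α where
  continuous_semigroup := continuous_heatOp
  norm_semigroup_sub_le t v w := by
    rw [← heatOp_sub]
    exact norm_heatOp_le t _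
  norm_semigroup_le := norm_heatOp_le
  continuous_nonlinearity := continuous_powerC₀ hα
  nonlinearity_zero := by ext x; simp [powerNonlinearity]
  lip_nonneg R hR := by positivity
  norm_nonlinearity_sub_le _ _ _ hv hw := norm_powerC₀_sub_le hα hv hw

theorem mildMap_heatOp_apply {α : ℝ} (hα : 0 < α) (lam : ℂ) (φ : C₀(𝔼, ℂ)) {u : ℝ → C₀(𝔼, ℂ)} {t : ℝ}
    (ht : 0 ≤ t) (hu : ContinuousOn u (Icc 0 t)) (x : 𝔼) :
    mildMap heatOp (powerC₀ α hα) lam φ u t x = heatSemigroup t φ x +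
      lam * ∫ s in (0 : ℝ)..t,
        heatSemigroup (t - s) (fun y => powerNonlinearity α (u s y)) x := by
  rw [mildMap, ZeroAtInftyContinuousMap.add_apply, ZeroAtInftyContinuousMap.smul_apply,
    smul_eq_mul, heatSemigroup_eq_heatOp]
  congr 2
  rw [← evalCLM_apply, ← ContinuousLinearMap.intervalIntegral_comp_comm _
    (intervalIntegrable_mildIntegrand (isMildPair_heatOp hα) ht hu)]
  refine intervalIntegral.integral_congr fun s _ => ?_
  exact (heatSemigroup_eq_heatOp (t - s) (powerC₀ α hα (u s)) x).symm

theorem isSolution_iff {α : ℝ} (hα : 0 < α) (lam : ℂ) (φ : C₀(𝔼, ℂ)) (T : EReal)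
    (u : ℝ → C₀(𝔼, ℂ)) :
    IsSolution α lam φ T u ↔ ContinuousOn u {t : ℝ | 0 ≤ t ∧ (t : EReal) < T} ∧
      ∀ t : ℝ, 0 ≤ t → (t : EReal) < T → u t = mildMap heatOp (powerC₀ α hα) lam φ u t := by
  have hsub : ∀ t : ℝ, (t : EReal) < T → Icc 0 t ⊆ {t : ℝ | 0 ≤ t ∧ (t : EReal) < T} :=
    fun t ht s hs => ⟨hs.1, lt_of_le_of_lt (EReal.coe_le_coe_iff.2 hs.2) ht⟩
  constructor
  · refine fun h => ⟨h.continuousOn, fun t h0 hT => ?_⟩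
    ext x
    rw [mildMap_heatOp_apply hα lam φ h0 (h.continuousOn.mono (hsub t hT)) x]
    exact h.duhamel t h0 hT x
  · refine fun h => ⟨h.1, fun t h0 hT x => ?_⟩
    rw [h.2 t h0 hT, mildMap_heatOp_apply hα lam φ h0 (h.1.mono (hsub t hT)) x]

theorem IsSolution.eq_of_lt {α : ℝ} (hα : 0 < α) {lam : ℂ} {φ : C₀(𝔼, ℂ)} {T₁ T₂ : EReal}
    {u v : ℝ → C₀(𝔼, ℂ)} (hu : IsSolution α lam φ T₁ u) (hv : IsSolution α lam φ T₂ v)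
    {t : ℝ} (h0 : 0 ≤ t) (h₁ : (t : EReal) < T₁) (h₂ : (t : EReal) < T₂) : u t = v t := by
  rw [isSolution_iff hα] at hu hv
  have hlt : ∀ {T : EReal}, (t : EReal) < T → ∀ s ∈ Icc 0 t, (s : EReal) < T :=
    fun h s hs => lt_of_le_of_lt (EReal.coe_le_coe_iff.2 hs.2) h
  exact eqOn_of_mildMap (isMildPair_heatOp hα) lam φ h0 (hu.1.mono fun s hs => ⟨hs.1, hlt h₁ s hs⟩)
    (hv.1.mono fun s hs => ⟨hs.1, hlt h₂ s hs⟩) (fun s hs => hu.2 s hs.1 (hlt h₁ s hs))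
    (fun s hs => hv.2 s hs.1 (hlt h₂ s hs)) ⟨h0, le_rfl⟩

/-- Uniqueness lets all solutions be glued into one on the supremum of their existence times; local
existence makes that supremum positive. -/
theorem exists_isMaximalSolution {α : ℝ} (hα : 0 < α) (lam : ℂ) (φ : C₀(𝔼, ℂ)) :
    ∃ (T : EReal) (u : ℝ → C₀(𝔼, ℂ)), IsMaximalSolution α lam φ T u := by
  classical
  set T : EReal := sSup {T' | ∃ v : ℝ → C₀(𝔼, ℂ), IsSolution α lam φ T' v} with hT
  let u : ℝ → C₀(𝔼, ℂ) := fun t =>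
    if h : ∃ v : ℝ → C₀(𝔼, ℂ), ∃ T', IsSolution α lam φ T' v ∧ (t : EReal) < T'
    then h.choose t else 0
  have hu : ∀ (T' : EReal) (v : ℝ → C₀(𝔼, ℂ)), IsSolution α lam φ T' v →
      ∀ t : ℝ, 0 ≤ t → (t : EReal) < T' → u t = v t := by
    intro T' v hv t h0 ht
    have h : ∃ v : ℝ → C₀(𝔼, ℂ), ∃ T', IsSolution α lam φ T' v ∧ (t : EReal) < T' :=
      ⟨v, T', hv, ht⟩
    obtain ⟨T₁, h₁, h₂⟩ := h.choose_spec
    rw [show u t = h.choose t from dif_pos h]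
    exact h₁.eq_of_lt hα hv h0 h₂ ht
  obtain ⟨τ, hτ, w, hw, hw'⟩ := exists_local_solution (isMildPair_heatOp hα) lam φ
  have hwsol : IsSolution α lam φ (τ : EReal) w := by
    rw [isSolution_iff hα]
    exact ⟨hw.continuousOn, fun t h0 h1 => hw' t ⟨h0, (EReal.coe_lt_coe_iff.1 h1).le⟩⟩
  refine ⟨T, u, ⟨?_, ⟨?_, ?_⟩, fun T' v hv => ⟨le_sSup ⟨v, hv⟩, fun t h0 h1 =>
    (hu T' v hv t h0 h1).symm⟩⟩⟩
  · exact lt_of_lt_of_le (EReal.coe_pos.2 hτ) (le_sSup ⟨w, hwsol⟩)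
  · rintro t ⟨h0, h1⟩
    obtain ⟨T', ⟨v, hv⟩, hlt⟩ := lt_sSup_iff.1 h1
    -- The interval of a local solution is a neighbourhood of `t` in the half-line, so continuity
    -- transfers to the glued function.
    have hnhds : {s : ℝ | (s : EReal) < T'} ∈ 𝓝 t :=
      (isOpen_lt continuous_coe_real_ereal continuous_const).mem_nhds hlt
    have h2 : ContinuousWithinAt u {t : ℝ | 0 ≤ t ∧ (t : EReal) < T'} t :=
      (hv.continuousOn t ⟨h0, hlt⟩).congr (fun s hs => hu T' v hv s hs.1 hs.2)
        (hu T' v hv t h0 hlt)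
    refine (h2.mono_of_mem_nhdsWithin ?_)
    filter_upwards [mem_nhdsWithin_of_mem_nhds hnhds, self_mem_nhdsWithin] with s hs hs'
    exact ⟨hs'.1, hs⟩
  · intro t h0 h1 x
    obtain ⟨T', ⟨v, hv⟩, hlt⟩ := lt_sSup_iff.1 h1
    rw [hu T' v hv t h0 hlt, hv.duhamel t h0 hlt x]
    congr 2
    refine intervalIntegral.integral_congr fun s hs => ?_
    rw [uIcc_of_le h0] at hs
    rw [hu T' v hv s hs.1 (lt_of_le_of_lt (EReal.coe_le_coe_iff.2 hs.2) hlt)]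

/-! ### Sobolev regularity bounds the pairings -/

theorem fourierInv_testSchwartz (i : Fin N) (c : Fin N → ℝ) (hc : ∀ i, 0 < c i) (ξ : 𝔼) :
    𝓕⁻ (testSchwartz i c hc) ξ = (2 * Real.pi * Complex.I * ξ i) ^ 5 *
      ((Real.exp (-(4 * Real.pi ^ 2 * ∑ i, c i * ξ i ^ 2)) : ℝ) : ℂ) := by
  have h : 𝓕⁻ (testSchwartz i c hc) ξ = 𝓕 (testSchwartz i c hc) (-ξ) := by
    rw [SchwartzMap.fourierInv_coe, SchwartzMap.fourier_coe, Real.fourierInv_eq_fourier_neg]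
  rw [h, fourier_testSchwartz]
  simp only [PiLp.neg_apply, neg_sq, Complex.ofReal_neg]
  ring

/-- In the `2π` normalisation of the Fourier transform, `exp (-r |ξ|²)` is the heat multiplier at
time `r / (4π²)`. -/
theorem exp_mul_fourierInv_testSchwartz (i : Fin N) (c : Fin N → ℝ) (hc : ∀ i, 0 < c i) {r : ℝ}
    (hc' : ∀ j, 0 < c j + r / (4 * Real.pi ^ 2)) (ξ : 𝔼) :
    ((Real.exp (-(r * ‖ξ‖ ^ 2)) : ℝ) : ℂ) * 𝓕⁻ (testSchwartz i c hc) ξ =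
      𝓕⁻ (testSchwartz i (fun j => c j + r / (4 * Real.pi ^ 2)) hc') ξ := by
  rw [fourierInv_testSchwartz, fourierInv_testSchwartz, mul_left_comm, ← Complex.ofReal_mul,
    ← Real.exp_add]
  congr 4
  simp only [add_mul, Finset.sum_add_distrib]
  rw [← Finset.mul_sum, ← EuclideanSpace.real_norm_sq_eq]
  field_simp
  ring

theorem rpow_neg_eq_integral {s : ℝ} (hs : 0 < s) (ξ : 𝔼) :
    ((1 + ‖ξ‖ ^ 2) ^ (-s / 2) : ℝ) = (Real.Gamma (s / 2))⁻¹ *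
      ∫ r in Ioi (0 : ℝ), r ^ (s / 2 - 1) * Real.exp (-r) * Real.exp (-(r * ‖ξ‖ ^ 2)) := by
  have h0 : 0 < 1 + ‖ξ‖ ^ 2 := by positivity
  have h := Real.integral_rpow_mul_exp_neg_mul_Ioi (half_pos hs) h0
  have hG := Real.Gamma_pos_of_pos (half_pos hs)
  have h1 : ∀ r : ℝ, r ^ (s / 2 - 1) * Real.exp (-r) * Real.exp (-(r * ‖ξ‖ ^ 2)) =
      r ^ (s / 2 - 1) * Real.exp (-((1 + ‖ξ‖ ^ 2) * r)) := fun r => by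
    rw [mul_assoc, ← Real.exp_add]
    congr 2
    ring
  simp_rw [h1, h]
  rw [mul_comm (_ ^ _), inv_mul_cancel_left₀ hG.ne', one_div, Real.inv_rpow h0.le,
    ← Real.rpow_neg h0.le, neg_div]

/-- Subordination: the Gamma integral writes `(1 + |ξ|²) ^ (-s/2)` as an average of heat
multipliers, each of which merely widens the test function. -/
theorem fourier_bessel_testSchwartz (i : Fin N) (c : Fin N → ℝ) (hc : ∀ i, 0 < c i) {s : ℝ}
    (hs : 0 < s) (x : 𝔼) :
    𝓕 (SchwartzMap.smulLeftCLM ℂ (fun ξ : 𝔼 => (((1 + ‖ξ‖ ^ 2) ^ (-s / 2) : ℝ) : ℂ))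
      (𝓕⁻ (testSchwartz i c hc))) x = (((Real.Gamma (s / 2))⁻¹ : ℝ) : ℂ) *
        ∫ r in Ioi (0 : ℝ), ((r ^ (s / 2 - 1) * Real.exp (-r) : ℝ) : ℂ) *
          (testFun i (fun j => c j + r / (4 * Real.pi ^ 2)) x : ℂ) := by
  have ht : (fun ξ : 𝔼 => (((1 + ‖ξ‖ ^ 2) ^ (-s / 2) : ℝ) : ℂ)).HasTemperateGrowth := by fun_prop
  set e : 𝔼 → ℂ := fun ξ => Complex.exp (((-2 * Real.pi * inner ℝ ξ x : ℝ) : ℂ) * Complex.I)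
    with he
  set G := 𝓕⁻ (testSchwartz i c hc) with hG
  have hpos : ∀ r ∈ Ioi (0 : ℝ), ∀ j, 0 < c j + r / (4 * Real.pi ^ 2) := fun r hr j => by
    have : (0 : ℝ) < r := hr
    have := hc j
    positivity
  have hinner : ∀ r ∈ Ioi (0 : ℝ), ∫ ξ, e ξ * (((Real.exp (-(r * ‖ξ‖ ^ 2)) : ℝ) : ℂ) * G ξ) =
      (testFun i (fun j => c j + r / (4 * Real.pi ^ 2)) x : ℂ) := by
    intro r hr
    have h1 : 𝓕 (𝓕⁻ (testSchwartz i _ (hpos r hr))) x = _ :=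
      congrArg (fun f : 𝓢(𝔼, ℂ) => f x) (FourierTransform.fourier_fourierInv_eq _)
    rw [SchwartzMap.fourier_coe, Real.fourier_eq', testSchwartz_apply] at h1
    rw [← h1]
    refine integral_congr_ae (Eventually.of_forall fun ξ => ?_)
    simp only [he, hG, smul_eq_mul]
    rw [exp_mul_fourierInv_testSchwartz i c hc (hpos r hr)]
  rw [SchwartzMap.fourier_coe, Real.fourier_eq']
  have hmul : ∀ ξ : 𝔼, e ξ • (SchwartzMap.smulLeftCLM ℂ
      (fun ξ : 𝔼 => (((1 + ‖ξ‖ ^ 2) ^ (-s / 2) : ℝ) : ℂ)) G) ξ =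
      (((Real.Gamma (s / 2))⁻¹ : ℝ) : ℂ) * ∫ r in Ioi (0 : ℝ),
        ((r ^ (s / 2 - 1) * Real.exp (-r) : ℝ) : ℂ) *
          (e ξ * (((Real.exp (-(r * ‖ξ‖ ^ 2)) : ℝ) : ℂ) * G ξ)) := by
    intro ξ
    rw [SchwartzMap.smulLeftCLM_apply_apply ht, rpow_neg_eq_integral hs, Complex.ofReal_mul,
      ← integral_complex_ofReal]
    simp only [smul_eq_mul]
    rw [mul_left_comm (e ξ), mul_assoc, ← integral_mul_const]
    congr 1
    refine integral_congr_ae (Eventually.of_forall fun r => ?_)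
    push_cast
    ring
  rw [integral_congr_ae (Eventually.of_forall hmul), integral_const_mul]
  congr 1
  rw [integral_integral_swap]
  · refine setIntegral_congr_fun measurableSet_Ioi fun r hr => ?_
    rw [integral_const_mul, hinner r hr]
  · have h1 : Integrable (fun r : ℝ => ((r ^ (s / 2 - 1) * Real.exp (-r) : ℝ) : ℂ))
        (volume.restrict (Ioi 0)) := by
      have := (Real.GammaIntegral_convergent (half_pos hs)).ofReal (𝕜 := ℂ)
      refine this.congr (Eventually.of_forall fun r => ?_)
      simp only [mul_comm]
      rfl
    have h2 := (G.integrable (μ := volume)).mul_prod h1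
    -- Replacing `r` by `max r 0` makes the exponential factor bounded everywhere without changing
    -- it on the domain of integration.
    have h3 := h2.bdd_mul (c := 1)
      (f := fun q : 𝔼 × ℝ => e q.1 * ((Real.exp (-(max q.2 0 * ‖q.1‖ ^ 2)) : ℝ) : ℂ))
      (by fun_prop : Continuous fun q : 𝔼 × ℝ =>
        e q.1 * ((Real.exp (-(max q.2 0 * ‖q.1‖ ^ 2)) : ℝ) : ℂ)).aestronglyMeasurable
      (Eventually.of_forall fun q => by
        rw [norm_mul, he, Complex.norm_exp_ofReal_mul_I, one_mul, Complex.norm_real,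
          Real.norm_of_nonneg (Real.exp_pos _).le, Real.exp_le_one_iff, neg_nonpos]
        positivity)
    refine h3.congr ?_
    have : ∀ᵐ q : 𝔼 × ℝ ∂(volume.prod (volume.restrict (Ioi 0))), q.2 ∈ Ioi (0 : ℝ) :=
      Measure.quasiMeasurePreserving_snd.ae (ae_restrict_mem measurableSet_Ioi)
    filter_upwards [this] with q hq
    have hq' : max q.2 0 = q.2 := max_eq_left (le_of_lt hq)
    simp only [Function.uncurry, hq']
    ring

theorem measurable_testFun_uncurry (i : Fin N) (c : Fin N → ℝ) :
    Measurable fun q : 𝔼 × ℝ => testFun i (fun j => c j + q.2 / (4 * Real.pi ^ 2)) q.1 := by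
  unfold testFun hermFactor gaussProd gauss
  fun_prop

/-- The bound is uniform as `c i → 0`. Write `v` as the Bessel potential of order `-s` of some `w`
in `L^p`, transfer the potential to the test function, and apply Hölder at each `r` in its heat
average. -/
theorem exists_norm_integral_testFun_le_of_memHsp {s : ℝ} {p : ℝ≥0∞} [Fact (1 ≤ p)] (hp : 1 < p)
    (hp' : p < ⊤) (hs : 5 + 1 / p.toReal < s) {v : C₀(𝔼, ℂ)} (hv : MemHsp s p v) (i : Fin N) :
    ∃ C : ℝ, ∀ c : Fin N → ℝ, 0 < c i → (∀ j, j ≠ i → 1 ≤ c j) →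
      ‖∫ x, testFun i c x • v x‖ ≤ C := by
  obtain ⟨w, hw⟩ := hv
  set P := p.toReal with hP
  have hP1 : 1 < P := by
    rw [hP, ← ENNReal.toReal_one]
    exact (ENNReal.toReal_lt_toReal ENNReal.one_ne_top hp'.ne).2 hp
  have hs0 : 0 < s := by
    have : 0 < 1 / P := by positivity
    linarith
  rw [← TemperedDistribution.besselPotential_neg_apply_eq_iff] at hw
  obtain ⟨C, hC, hCle⟩ := exists_lintegral_mul_testFun_le (N := N) hP1
  set W : ℝ≥0∞ := (∫⁻ x, ‖w x‖ₑ ^ P) ^ (1 / P) with hW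
  have hWtop : W < ⊤ := by
    have h := (Lp.memLp w).2
    rwa [eLpNorm_eq_lintegral_rpow_enorm_toReal (by positivity) hp'.ne] at h
  set A := (4 * Real.pi ^ 2) ^ (5 / 2 + 1 / (2 * P)) with hA
  set J : ℝ≥0∞ := ∫⁻ r in Ioi (0 : ℝ),
    ENNReal.ofReal (Real.exp (-r) * r ^ (s / 2 - 5 / 2 - 1 / (2 * P) - 1)) with hJ
  -- A Gamma integral; its parameter `s/2 - 5/2 - 1/(2P)` is positive exactly when `s > 5 + 1/P`.
  have hJtop : J < ⊤ := by
    refine (Real.GammaIntegral_convergent ?_).lintegral_lt_top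
    have : 1 / (2 * P) = 1 / P / 2 := by rw [div_div, mul_comm]
    rw [this]
    linarith
  set B : ℝ≥0∞ := ENNReal.ofReal (Real.Gamma (s / 2))⁻¹ * (W * ENNReal.ofReal (C * A) * J) with hB
  have hBtop : B ≠ ⊤ := by
    rw [hB]
    exact ENNReal.mul_ne_top ENNReal.ofReal_ne_top
      (ENNReal.mul_ne_top (ENNReal.mul_ne_top hWtop.ne ENNReal.ofReal_ne_top) hJtop.ne)
  refine ⟨B.toReal, fun c hi hc => ?_⟩
  have hc0 : ∀ j, 0 < c j := fun j => by
    rcases eq_or_ne j i with rfl | hj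
    · exact hi
    · linarith [hc j hj]
  have h1 : ∫ x, testFun i c x • v x = toDistribution v (testSchwartz i c hc0) := by
    rw [toDistribution_apply]
    simp only [testSchwartz_apply, Complex.real_smul]
  rw [h1, ← hw, TemperedDistribution.besselPotential,
    TemperedDistribution.fourierMultiplierCLM_apply_apply, Lp.toTemperedDistribution_apply]
  rw [← toReal_enorm]
  refine ENNReal.toReal_mono hBtop ?_
  refine (enorm_integral_le_lintegral_enorm _).trans ?_
  have hk0 : ∀ r : ℝ, 0 < r → 0 ≤ r ^ (s / 2 - 1) * Real.exp (-r) := fun r hr => by positivity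
  have h2 : ∀ x : 𝔼, ‖𝓕 (SchwartzMap.smulLeftCLM ℂ
      (fun ξ : 𝔼 => (((1 + ‖ξ‖ ^ 2) ^ (-s / 2) : ℝ) : ℂ)) (𝓕⁻ (testSchwartz i c hc0))) x • w x‖ₑ ≤
      ENNReal.ofReal (Real.Gamma (s / 2))⁻¹ * ∫⁻ r in Ioi (0 : ℝ),
        ENNReal.ofReal (r ^ (s / 2 - 1) * Real.exp (-r)) * (‖w x‖ₑ *
          ENNReal.ofReal |testFun i (fun j => c j + r / (4 * Real.pi ^ 2)) x|) := by
    intro x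
    have hG := Real.Gamma_pos_of_pos (half_pos hs0)
    rw [fourier_bessel_testSchwartz i c hc0 hs0, enorm_smul, enorm_mul, mul_assoc]
    have e1 : ‖(((Real.Gamma (s / 2))⁻¹ : ℝ) : ℂ)‖ₑ = ENNReal.ofReal (Real.Gamma (s / 2))⁻¹ := by
      rw [← ofReal_norm, Complex.norm_real, Real.norm_of_nonneg (by positivity)]
    rw [e1]
    gcongr
    refine (mul_le_mul_left (enorm_integral_le_lintegral_enorm _) _).trans (le_of_eq ?_)
    rw [← lintegral_mul_const']
    · refine setLIntegral_congr_fun measurableSet_Ioi fun r hr => ?_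
      rw [enorm_mul, ← ofReal_norm, ← ofReal_norm, Complex.norm_real, Complex.norm_real,
        Real.norm_of_nonneg (hk0 r hr), Real.norm_eq_abs, mul_assoc, mul_comm ‖w x‖ₑ]
    · exact enorm_ne_top
  refine (lintegral_mono h2).trans ?_
  rw [lintegral_const_mul' _ _ ENNReal.ofReal_ne_top, hB]
  gcongr
  have hwm : Measurable w := (Lp.stronglyMeasurable w).measurable
  rw [lintegral_lintegral_swap]
  · rw [hJ, ← lintegral_const_mul' _ _
      (ENNReal.mul_ne_top hWtop.ne ENNReal.ofReal_ne_top)]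
    refine setLIntegral_mono' measurableSet_Ioi fun r hr => ?_
    have hr0 : (0 : ℝ) < r := hr
    rw [lintegral_const_mul' _ _ ENNReal.ofReal_ne_top]
    have hr' : 0 < r / (4 * Real.pi ^ 2) := by positivity
    have h3 := hCle i (fun j => c j + r / (4 * Real.pi ^ 2)) (by positivity)
      (fun j hj => by have := hc j hj; linarith) (fun x => ‖w x‖ₑ) hwm.enorm.aemeasurable
    refine (mul_le_mul_right h3 _).trans ?_
    rw [mul_left_comm, mul_assoc, ← ENNReal.ofReal_mul (hk0 r hr0),
      ← ENNReal.ofReal_mul (by positivity)]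
    refine mul_le_mul' (le_of_eq hW.symm) (ENNReal.ofReal_le_ofReal ?_)
    -- The exponent is negative, so dropping `c i` only increases the bound and removes all
    -- dependence on `c`.
    have h4 : (c i + r / (4 * Real.pi ^ 2)) ^ (-(5 / 2) - 1 / (2 * P)) ≤
        A * r ^ (-(5 / 2) - 1 / (2 * P)) := by
      calc _ ≤ (r / (4 * Real.pi ^ 2)) ^ (-(5 / 2) - 1 / (2 * P)) := by
            refine Real.rpow_le_rpow_of_nonpos hr' (by linarith) ?_
            have : 0 < 1 / (2 * P) := by positivity
            linarith
        _ = _ := by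
            rw [Real.div_rpow hr0.le (by positivity), hA, div_eq_inv_mul,
              ← Real.rpow_neg (by positivity)]
            congr 2
            ring
    calc _ ≤ r ^ (s / 2 - 1) * Real.exp (-r) * (C * (A * r ^ (-(5 / 2) - 1 / (2 * P)))) := by
          gcongr
      _ = C * A * (Real.exp (-r) * (r ^ (s / 2 - 1) * r ^ (-(5 / 2) - 1 / (2 * P)))) := by ring
      _ = _ := by
          rw [← Real.rpow_add hr0]
          congr 3
          ring
  · refine Measurable.aemeasurable ?_
    have := measurable_testFun_uncurry i c
    simp only [Function.uncurry_def]
    fun_prop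

/-! ### Odd solutions near the hyperplane of antisymmetry -/

theorem gauss_le_gauss {a : ℝ} (ha : 0 < a) {x y : ℝ} (h : x ^ 2 ≤ y ^ 2) :
    gauss a y ≤ gauss a x := by
  unfold gauss
  gcongr

/-- For `x ≥ 0` the integrand is even in `y`, and on `y > 0` the difference has a fixed sign. The
integral is therefore twice the mass of the kernel on `[-x, x]`. -/
theorem integral_abs_gauss_sub_le {a : ℝ} (ha : 0 < a) (x : ℝ) :
    ∫ y, |gauss a (x - y) - gauss a (-x - y)| ≤ 4 * |x| * (√a)⁻¹ := by
  wlog hx : 0 ≤ x generalizing x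
  · have h := this (-x) (by linarith)
    simp only [neg_neg, abs_neg] at h
    refine le_trans (le_of_eq ?_) h
    exact integral_congr_ae (Eventually.of_forall fun y => abs_sub_comm _ _)
  have h1 : ∀ y : ℝ, |gauss a (x - y) - gauss a (-x - y)| =
      (fun r => gauss a (r - x) - gauss a (r + x)) |y| := by
    intro y
    have e1 : gauss a (x - y) = gauss a (y - x) := by rw [← neg_sub, gauss_neg]
    have e2 : gauss a (-x - y) = gauss a (y + x) := by rw [← gauss_neg]; congr 1; ring
    rcases abs_cases y with ⟨h, hy⟩ | ⟨h, hy⟩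
    · simp only [h, e1, e2]
      refine abs_of_nonneg (sub_nonneg.2 (gauss_le_gauss ha ?_))
      nlinarith
    · have e3 : gauss a (-y - x) = gauss a (y + x) := by rw [← gauss_neg]; congr 1; ring
      have e4 : gauss a (-y + x) = gauss a (y - x) := by rw [← gauss_neg]; congr 1; ring
      simp only [h, e1, e2, e3, e4]
      rw [abs_sub_comm]
      refine abs_of_nonneg (sub_nonneg.2 (gauss_le_gauss ha ?_))
      nlinarith
  have hg := integrable_gauss ha
  have s1 : ∫ y in Ioi (0 : ℝ), gauss a (y - x) = ∫ y in Ioi (-x), gauss a y := by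
    have h := (measurePreserving_sub_right volume x).setIntegral_preimage_emb
      (measurableEmbedding_subRight x) (gauss a) (Ioi (-x))
    simpa using h
  have s2 : ∫ y in Ioi (0 : ℝ), gauss a (y + x) = ∫ y in Ioi x, gauss a y := by
    have h := (measurePreserving_add_right volume x).setIntegral_preimage_emb
      (measurableEmbedding_addRight x) (gauss a) (Ioi x)
    simpa using h
  simp_rw [h1]
  rw [integral_comp_abs (f := fun r => gauss a (r - x) - gauss a (r + x)),
    integral_sub (hg.comp_sub_right x).integrableOn (hg.comp_add_right x).integrableOn, s1, s2,
    intervalIntegral.integral_Ioi_sub_Ioi hg.integrableOn (by linarith), abs_of_nonneg hx]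
  have h2 : ∫ y in (-x)..x, gauss a y ≤ ∫ _ in (-x)..x, (√a)⁻¹ :=
    intervalIntegral.integral_mono_on (by linarith) hg.intervalIntegrable
      intervalIntegrable_const fun y _ => gauss_le ha y
  rw [intervalIntegral.integral_const, smul_eq_mul] at h2
  linarith

/-- Reflection in the hyperplane `x i = 0`. -/
def reflect (i : Fin N) : 𝔼 ≃ₗᵢ[ℝ] 𝔼 :=
  LinearIsometryEquiv.piLpCongrRight 2 fun j =>
    if j = i then LinearIsometryEquiv.neg ℝ else LinearIsometryEquiv.refl ℝ ℝ

theorem reflect_apply (i : Fin N) (x : 𝔼) (j : Fin N) :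
    reflect i x j = if j = i then -x j else x j := by
  rw [reflect, LinearIsometryEquiv.piLpCongrRight_apply]
  split_ifs with h <;> simp [h]

theorem reflect_reflect (i : Fin N) (x : 𝔼) : reflect i (reflect i x) = x := by
  ext j
  simp only [reflect_apply]
  split_ifs <;> simp

theorem norm_sub_reflect (i : Fin N) (x : 𝔼) : ‖x - reflect i x‖ = 2 * |x i| := by
  have h : x - reflect i x = EuclideanSpace.single i (2 * x i) := by
    ext j
    rw [PiLp.sub_apply, reflect_apply, PiLp.single_apply]
    split_ifs with h
    · rw [h]; ring
    · ring
  rw [h, PiLp.norm_single, Real.norm_eq_abs, abs_mul, abs_two]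

theorem gaussProd_reflect (i : Fin N) (c : Fin N → ℝ) (x : 𝔼) :
    gaussProd c (reflect i x) = gaussProd c x := by
  refine Finset.prod_congr rfl fun j _ => ?_
  rw [reflect_apply]
  split_ifs
  · rw [gauss_neg]
  · rfl

/-- The odd reflection `v ↦ -(v ∘ reflect i)` on `C₀`. -/
def oddReflect (i : Fin N) : C₀(𝔼, ℂ) →L[ℂ] C₀(𝔼, ℂ) :=
  LinearMap.mkContinuous
    ⟨⟨fun v => -(v.comp (reflect i).toHomeomorph.toCocompactMap), fun v w => by
      ext x
      exact neg_add (v _) (w _)⟩, fun c v => by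
      ext x
      exact (mul_neg c (v _)).symm⟩ 1
    fun v => by
      rw [one_mul]
      refine norm_le_of_forall (norm_nonneg v) fun x => ?_
      exact (norm_neg _).trans_le (norm_apply_le v (reflect i x))

theorem oddReflect_apply (i : Fin N) (v : C₀(𝔼, ℂ)) (x : 𝔼) :
    oddReflect i v x = -v (reflect i x) := rfl

theorem heatOp_oddReflect (i : Fin N) (t : ℝ) (v : C₀(𝔼, ℂ)) :
    heatOp t (oddReflect i v) = oddReflect i (heatOp t v) := by
  ext x
  rw [oddReflect_apply, heatOp_apply, heatOp_apply, ← integral_neg,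
    ← (reflect i).measurePreserving.integral_comp (reflect i).toHomeomorph.measurableEmbedding]
  refine integral_congr_ae (Eventually.of_forall fun z => ?_)
  simp only
  rw [gaussProd_reflect, oddReflect_apply, map_sub, map_smul, reflect_reflect, smul_neg]

theorem powerC₀_oddReflect (i : Fin N) {α : ℝ} (hα : 0 < α) (v : C₀(𝔼, ℂ)) :
    powerC₀ α hα (oddReflect i v) = oddReflect i (powerC₀ α hα v) := by
  ext x
  simp only [powerC₀_apply, oddReflect_apply, powerNonlinearity_neg]

theorem mildMap_oddReflect (i : Fin N) {α : ℝ} (hα : 0 < α) (lam : ℂ) (φ : C₀(𝔼, ℂ))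
    {u : ℝ → C₀(𝔼, ℂ)} {t : ℝ} (ht : 0 ≤ t) (hu : ContinuousOn u (Icc 0 t)) :
    mildMap heatOp (powerC₀ α hα) lam (oddReflect i φ) (fun s => oddReflect i (u s)) t =
      oddReflect i (mildMap heatOp (powerC₀ α hα) lam φ u t) := by
  rw [mildMap, mildMap, map_add, map_smul, ← ContinuousLinearMap.intervalIntegral_comp_comm _
    (intervalIntegrable_mildIntegrand (isMildPair_heatOp hα) ht hu)]
  simp only [heatOp_oddReflect, powerC₀_oddReflect]

/-- Solutions with odd initial value are odd. -/
theorem IsSolution.oddReflect_eq (i : Fin N) {α : ℝ} (hα : 0 < α) {lam : ℂ} {φ : C₀(𝔼, ℂ)}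
    {T : EReal} {u : ℝ → C₀(𝔼, ℂ)} (hu : IsSolution α lam φ T u) (hφ : oddReflect i φ = φ)
    {t : ℝ} (h0 : 0 ≤ t) (hT : (t : EReal) < T) : oddReflect i (u t) = u t := by
  have hv : IsSolution α lam φ T fun s => oddReflect i (u s) := by
    have hu' := (isSolution_iff hα lam φ T u).1 hu
    refine (isSolution_iff hα lam φ T _).2
      ⟨(oddReflect i).continuous.comp_continuousOn hu'.1, fun t h0 hT => ?_⟩
    have h := mildMap_oddReflect i hα lam φ (u := u) h0 (hu'.1.mono fun s hs =>
      ⟨hs.1, lt_of_le_of_lt (EReal.coe_le_coe_iff.2 hs.2) hT⟩)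
    rw [hφ] at h
    rw [h, ← hu'.2 t h0 hT]
  exact hv.eq_of_lt hα hu h0 hT hT

/-- Oddness converts an estimate of a difference across the hyperplane into a pointwise one; this is
how the factor `|x i|` arises. -/
theorem two_mul_norm_le_of_oddReflect {i : Fin N} {v : C₀(𝔼, ℂ)} (hv : oddReflect i v = v)
    (x : 𝔼) : 2 * ‖v x‖ = ‖v x - v (reflect i x)‖ := by
  have h : v (reflect i x) = -v x := by
    conv_rhs => rw [← hv]
    rw [oddReflect_apply, neg_neg]
  rw [h, sub_neg_eq_add, ← two_mul, norm_mul, Complex.norm_ofNat]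

/-- The kernels centred at `x` and at its reflection differ only in their `i`-th factor, so the
one-dimensional estimate applies and the other factors integrate to `1`. -/
theorem norm_heatOp_sub_reflect_le (i : Fin N) {t : ℝ} (ht : 0 < t) (v : C₀(𝔼, ℂ)) (x : 𝔼) :
    ‖heatOp t v x - heatOp t v (reflect i x)‖ ≤ 4 * |x i| * (√t)⁻¹ * ‖v‖ := by
  have hK := integrable_gaussProd (N := N) (c := fun _ => t) fun _ => ht
  have hi : ∀ x : 𝔼, Integrable fun y : 𝔼 => gaussProd (fun _ => t) (x - y) :=
    fun x => hK.comp_sub_left x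
  rw [← heatSemigroup_eq_heatOp, ← heatSemigroup_eq_heatOp, heatSemigroup_eq ht,
    heatSemigroup_eq ht, ← integral_sub (integrable_smul_apply (hi _) v)
      (integrable_smul_apply (hi _) v)]
  refine (norm_integral_le_of_norm_le (((hi x).sub (hi (reflect i x))).norm.mul_const ‖v‖)
    (Eventually.of_forall fun y => ?_)).trans ?_
  · rw [← sub_smul, norm_smul]
    gcongr
    · rfl
    · exact norm_apply_le v y
  · rw [integral_mul_const]
    gcongr
    have h1 : ∀ y : 𝔼, ‖((fun y : 𝔼 => gaussProd (fun _ => t) (x - y)) -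
        fun y : 𝔼 => gaussProd (fun _ => t) (reflect i x - y)) y‖ =
        ∏ j, (fun (j : Fin N) (r : ℝ) => if j = i then
          |gauss t (x i - r) - gauss t (-x i - r)| else gauss t (x j - r)) j (y j) := by
      intro y
      rw [Pi.sub_apply, Real.norm_eq_abs, gaussProd_eq_mul i, gaussProd_eq_mul i,
        ← Finset.mul_prod_erase _ _ (Finset.mem_univ i)]
      have h2 : ∏ j ∈ Finset.univ.erase i, gauss t ((reflect i x - y) j) =
          ∏ j ∈ Finset.univ.erase i, gauss t ((x - y) j) := by
        refine Finset.prod_congr rfl fun j hj => ?_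
        rw [PiLp.sub_apply, reflect_apply, if_neg (Finset.ne_of_mem_erase hj), PiLp.sub_apply]
      rw [h2, ← sub_mul, abs_mul, abs_of_nonneg (a := Finset.prod _ _)
        (Finset.prod_nonneg fun _ _ => gauss_nonneg _ _)]
      simp only [PiLp.sub_apply, reflect_apply, if_true]
      congr 1
      refine Finset.prod_congr rfl fun j hj => ?_
      rw [if_neg (Finset.ne_of_mem_erase hj)]
    rw [integral_congr_ae (Eventually.of_forall h1)]
    refine (integral_prod_coord (fun (j : Fin N) (r : ℝ) => if j = i then
          |gauss t (x i - r) - gauss t (-x i - r)| else gauss t (x j - r))).trans_le ?_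
    rw [← Finset.mul_prod_erase _ _ (Finset.mem_univ i), Finset.prod_eq_one, mul_one]
    · simp only [if_true]
      exact integral_abs_gauss_sub_le ht (x i)
    · intro j hj
      simp only [if_neg (Finset.ne_of_mem_erase hj)]
      rw [integral_sub_left_eq_self (gauss t), integral_gauss ht]

/-- The increment `x ↦ f (x - k) - f x` has derivative at most `L * ‖k‖`, because `fderiv ℝ f` is
Lipschitz; the mean value inequality concludes. -/
theorem exists_norm_sub_sub_le {f : 𝔼 → ℂ} (hf : ContDiff ℝ ∞ f) (hfc : HasCompactSupport f) :
    ∃ L : ℝ, 0 ≤ L ∧ ∀ x y k : 𝔼,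
      ‖(f (x - k) - f x) - (f (y - k) - f y)‖ ≤ L * ‖k‖ * ‖x - y‖ := by
  have hf' : ContDiff ℝ 1 (fderiv ℝ f) := hf.fderiv_right (m := 1) (by norm_cast)
  obtain ⟨L, hL⟩ := ContDiff.lipschitzWith_of_hasCompactSupport (𝕂 := ℝ) (n := 1)
    (hfc.fderiv (𝕜 := ℝ)) hf' one_ne_zero
  have hd : Differentiable ℝ f := hf.differentiable (by simp)
  refine ⟨L, L.2, fun x y k => ?_⟩
  refine Convex.norm_image_sub_le_of_norm_hasFDerivWithin_le
    (f := fun x => f (x - k) - f x) (f' := fun x => fderiv ℝ f (x - k) - fderiv ℝ f x)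
    (fun z _ => ?_) (fun z _ => ?_) convex_univ (mem_univ y) (mem_univ x)
  · refine (HasFDerivAt.sub ?_ (hd z).hasFDerivAt).hasFDerivWithinAt
    have h1 := (hd (z - k)).hasFDerivAt.comp z ((hasFDerivAt_id z).sub_const k)
    simpa using! h1
  · have h2 := hL.dist_le_mul (z - k) z
    rw [dist_eq_norm, dist_eq_norm] at h2
    simpa using h2

theorem integrable_gaussProd_mul_norm :
    Integrable fun z : 𝔼 => gaussProd (fun _ => 1) z * ‖z‖ := by
  have h := (gaussSchwartz (N := N) (fun _ => 1) fun _ => one_pos).integrable_pow_mul volume 1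
  refine h.congr (Eventually.of_forall fun z => ?_)
  simp only [pow_one, gaussSchwartz_apply, Complex.norm_real]
  rw [Real.norm_of_nonneg (gaussProd_nonneg _ _), mul_comm]

/-- Average the mixed second difference with `k = √t • z`: the two points are `2 * |x i|` apart, and
the first moment of the Gaussian is finite. -/
theorem exists_norm_heatOp_sub_self_sub_reflect_le {φ : C₀(𝔼, ℂ)} (hφ : ContDiff ℝ ∞ φ)
    (hφc : HasCompactSupport φ) (i : Fin N) : ∃ C : ℝ, 0 ≤ C ∧ ∀ (t : ℝ) (x : 𝔼),
      ‖(heatOp t φ - φ) x - (heatOp t φ - φ) (reflect i x)‖ ≤ C * √t * |x i| := by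
  obtain ⟨L, hL, h⟩ := exists_norm_sub_sub_le hφ hφc
  set m := ∫ z : 𝔼, gaussProd (fun _ => 1) z * ‖z‖ with hm
  have hm0 : 0 ≤ m := integral_nonneg fun z => mul_nonneg (gaussProd_nonneg _ _) (norm_nonneg z)
  have hK := integrable_gaussProd (N := N) (c := fun _ => 1) fun _ => one_pos
  refine ⟨2 * L * m, by positivity, fun t x => ?_⟩
  have hint : ∀ x : 𝔼, Integrable fun z : 𝔼 => gaussProd (fun _ => 1) z • φ (x - √t • z) :=
    fun x => by
      have := (evalCLM x).integrable_comp (integrable_heatOp t φ)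
      exact this
  have h1 : ∀ x : 𝔼, (heatOp t φ - φ) x =
      ∫ z : 𝔼, gaussProd (fun _ => 1) z • (φ (x - √t • z) - φ x) := by
    intro x
    simp only [smul_sub]
    rw [integral_sub (hint x) (hK.smul_const _), integral_smul_const,
      integral_gaussProd fun _ => one_pos, one_smul, ZeroAtInftyContinuousMap.sub_apply,
      heatOp_apply]
  have hint' : ∀ x : 𝔼, Integrable fun z : 𝔼 =>
      gaussProd (fun _ => 1) z • (φ (x - √t • z) - φ x) := fun x => by
    simp only [smul_sub]
    exact (hint x).sub (hK.smul_const _)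
  rw [h1, h1, ← integral_sub (hint' _) (hint' _)]
  refine (norm_integral_le_of_norm_le
    (integrable_gaussProd_mul_norm.const_mul (2 * L * √t * |x i|))
    (Eventually.of_forall fun z => ?_)).trans (le_of_eq ?_)
  · rw [← smul_sub, norm_smul, Real.norm_of_nonneg (gaussProd_nonneg _ _)]
    have h2 := h x (reflect i x) (√t • z)
    rw [norm_sub_reflect, norm_smul, Real.norm_of_nonneg (Real.sqrt_nonneg t)] at h2
    refine (mul_le_mul_of_nonneg_left h2 (gaussProd_nonneg _ _)).trans (le_of_eq ?_)
    ring
  · rw [integral_const_mul]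
    ring

theorem integral_inv_sqrt_sub {t : ℝ} (ht : 0 ≤ t) :
    IntervalIntegrable (fun s => (√(t - s))⁻¹) volume 0 t ∧
      ∫ s in (0 : ℝ)..t, (√(t - s))⁻¹ = 2 * √t := by
  have h0 : ∀ r : ℝ, (√r)⁻¹ = if 0 ≤ r then r ^ (-(1 / 2) : ℝ) else 0 := by
    intro r
    split_ifs with hr
    · rw [Real.rpow_neg hr, Real.sqrt_eq_rpow]
    · rw [Real.sqrt_eq_zero_of_nonpos (not_le.1 hr).le, inv_zero]
  have h1 : IntervalIntegrable (fun r => (√r)⁻¹) volume 0 t := by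
    refine (intervalIntegral.intervalIntegrable_rpow' (r := -(1 / 2)) (by norm_num)).congr ?_
    intro r hr
    rw [uIoc_of_le ht] at hr
    exact ((h0 r).trans (if_pos hr.1.le)).symm
  refine ⟨by simpa using (h1.comp_sub_left t).symm, ?_⟩
  rw [intervalIntegral.integral_comp_sub_left (fun r => (√r)⁻¹) t, sub_self, sub_zero]
  have h2 : ∫ r in (0 : ℝ)..t, (√r)⁻¹ = ∫ r in (0 : ℝ)..t, r ^ (-(1 / 2) : ℝ) := by
    refine intervalIntegral.integral_congr fun r hr => ?_
    rw [uIcc_of_le ht] at hr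
    rw [h0, if_pos hr.1]
  rw [h2, integral_rpow (Or.inl (by norm_num)), Real.sqrt_eq_rpow]
  norm_num [Real.zero_rpow]
  ring

/-- An odd solution stays close to its initial value, relative to the distance from the
hyperplane of antisymmetry. -/
theorem IsSolution.exists_norm_sub_le (i : Fin N) {α : ℝ} (hα : 0 < α) {lam : ℂ} {φ : C₀(𝔼, ℂ)}
    {T : EReal} {u : ℝ → C₀(𝔼, ℂ)} (hu : IsSolution α lam φ T u) (hφ : oddReflect i φ = φ)
    (hφs : ContDiff ℝ ∞ φ) (hφc : HasCompactSupport φ) {b : ℝ} (hb : (b : EReal) < T) :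
    ∃ C : ℝ, 0 ≤ C ∧ ∀ t ∈ Icc 0 b, ∀ x : 𝔼, ‖u t x - φ x‖ ≤ C * √t * |x i| := by
  have hlt : ∀ t ∈ Icc 0 b, (t : EReal) < T :=
    fun t ht => lt_of_le_of_lt (EReal.coe_le_coe_iff.2 ht.2) hb
  have hcont : ContinuousOn u (Icc 0 b) := hu.continuousOn.mono fun t ht => ⟨ht.1, hlt t ht⟩
  obtain ⟨C₁, hC₁, h₁⟩ := exists_norm_heatOp_sub_self_sub_reflect_le hφs hφc i
  obtain ⟨R, hR⟩ := isCompact_Icc.exists_bound_of_continuousOn hcont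
  set M := (2 + α) * |R| ^ α * |R| with hM
  have hM0 : 0 ≤ M := by positivity
  refine ⟨C₁ + 8 * ‖lam‖ * M, by positivity, fun t ht x => ?_⟩
  have hcont' : ContinuousOn u (Icc 0 t) := hcont.mono (Icc_subset_Icc_right ht.2)
  have hodd : oddReflect i (u t - φ) = u t - φ := by
    rw [map_sub, hφ, hu.oddReflect_eq i hα hφ ht.1 (hlt t ht)]
  have h2 := two_mul_norm_le_of_oddReflect hodd x
  set I := ∫ s in (0 : ℝ)..t, heatOp (t - s) (powerC₀ α hα (u s)) with hI
  have hut : u t = mildMap heatOp (powerC₀ α hα) lam φ u t :=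
    ((isSolution_iff hα lam φ T u).1 hu).2 t ht.1 (hlt t ht)
  have hdec : ∀ y, (u t - φ) y = (heatOp t φ - φ) y + lam * I y := fun y => by
    rw [hut, mildMap]
    simp only [ZeroAtInftyContinuousMap.sub_apply, ZeroAtInftyContinuousMap.add_apply,
      ZeroAtInftyContinuousMap.smul_apply, smul_eq_mul]
    ring
  -- The smoothing bound costs `(t - s) ^ (-1/2)`, whose integral is `2 * √t`, so the Duhamel term
  -- is as small as the linear one.
  have hII : ‖I x - I (reflect i x)‖ ≤ 4 * |x i| * M * (2 * √t) := by
    have hint := intervalIntegrable_mildIntegrand (isMildPair_heatOp hα) ht.1 hcont'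
    have h3 : I x - I (reflect i x) = ∫ s in (0 : ℝ)..t, (evalCLM x - evalCLM (reflect i x))
        (heatOp (t - s) (powerC₀ α hα (u s))) := by
      rw [ContinuousLinearMap.intervalIntegral_comp_comm _ hint]
      rfl
    rw [h3, ← (integral_inv_sqrt_sub ht.1).2, ← intervalIntegral.integral_const_mul]
    refine intervalIntegral.norm_integral_le_of_norm_le ht.1 ?_
      ((integral_inv_sqrt_sub ht.1).1.const_mul _)
    have hne : ∀ᵐ s : ℝ, s ≠ t := by simp [ae_iff]
    filter_upwards [hne] with s hs hs'
    have hst : 0 < t - s := sub_pos.2 (lt_of_le_of_ne hs'.2 hs)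
    have h4 := norm_heatOp_sub_reflect_le i hst (powerC₀ α hα (u s)) x
    have h5 : ‖powerC₀ α hα (u s)‖ ≤ M :=
      (isMildPair_heatOp hα).norm_nonlinearity_le
        ((hR s ⟨hs'.1.le, hs'.2.trans ht.2⟩).trans (le_abs_self R))
    refine h4.trans ?_
    rw [mul_right_comm _ M]
    gcongr
  have h6 : 2 * ‖(u t - φ) x‖ ≤ C₁ * √t * |x i| + ‖lam‖ * (4 * |x i| * M * (2 * √t)) := by
    rw [h2, hdec, hdec, add_sub_add_comm, ← mul_sub]
    refine (norm_add_le _ _).trans (add_le_add (h₁ t x) ?_)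
    rw [norm_mul]
    gcongr
  have h7 : 0 ≤ ‖(u t - φ) x‖ := norm_nonneg _
  calc ‖u t x - φ x‖ = ‖(u t - φ) x‖ := rfl
    _ ≤ C₁ * √t * |x i| + ‖lam‖ * (4 * |x i| * M * (2 * √t)) := by linarith
    _ = _ := by ring

/-! ### The initial value and its singular pairing -/

/-- A smooth even cutoff function on `ℝ`, equal to `1` on `[-1, 1]` and to `0` off `[-2, 2]`. -/
def cutoff : ContDiffBump (0 : ℝ) := ⟨1, 2, one_pos, one_lt_two⟩

theorem cutoff_eq_one {y : ℝ} (hy : |y| ≤ 1) : cutoff y = 1 :=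
  cutoff.one_of_mem_closedBall (by simpa [cutoff] using hy)

theorem cutoff_eq_zero {y : ℝ} (hy : 2 ≤ |y|) : cutoff y = 0 :=
  cutoff.zero_of_le_dist (by simpa [cutoff] using hy)

/-- The image `|ψ|^α ψ` of the cutoff function under the nonlinearity. -/
def cutoffPow (α y : ℝ) : ℝ := cutoff y ^ α * cutoff y

theorem cutoffPow_nonneg (α y : ℝ) : 0 ≤ cutoffPow α y :=
  mul_nonneg (Real.rpow_nonneg cutoff.nonneg _) cutoff.nonneg

theorem cutoffPow_le_one {α : ℝ} (hα : 0 ≤ α) (y : ℝ) : cutoffPow α y ≤ 1 :=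
  mul_le_one₀ (Real.rpow_le_one cutoff.nonneg cutoff.le_one hα) cutoff.nonneg cutoff.le_one

theorem cutoffPow_eq_one {α y : ℝ} (hy : |y| ≤ 1) : cutoffPow α y = 1 := by
  rw [cutoffPow, cutoff_eq_one hy, Real.one_rpow, one_mul]

theorem continuous_cutoffPow {α : ℝ} (hα : 0 ≤ α) : Continuous (cutoffPow α) :=
  (cutoff.continuous.rpow_const fun _ => Or.inr hα).mul cutoff.continuous

theorem integrable_abs_rpow_mul_hermFactor {β a : ℝ} (hβ : 0 ≤ β) (ha : 0 < a) :
    Integrable fun y : ℝ => |y| ^ β * (|hermFactor a y| * gauss a y) := by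
  obtain ⟨C, -, h⟩ := exists_abs_rpow_mul_hermFactor_le hβ
  refine ((integrable_gauss (by positivity : 0 < 2 * a)).const_mul
    (C * a ^ (β / 2 - 5 / 2))).mono' ?_ (Eventually.of_forall fun y => ?_)
  · exact ((continuous_abs.rpow_const fun _ => Or.inr hβ).mul
      ((continuous_hermFactor a).abs.mul (continuous_gauss a))).aestronglyMeasurable
  · rw [Real.norm_of_nonneg
      (mul_nonneg (by positivity) (mul_nonneg (abs_nonneg _) (gauss_nonneg _ _)))]
    exact h a ha y

theorem integrable_cutoffPow_mul_gauss {α a : ℝ} (hα : 0 ≤ α) (ha : 0 < a) :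
    Integrable fun y => cutoffPow α y * gauss a y :=
  (integrable_gauss ha).mono'
    ((continuous_cutoffPow hα).mul (continuous_gauss a)).aestronglyMeasurable
    (Eventually.of_forall fun y => by
      rw [Real.norm_of_nonneg (mul_nonneg (cutoffPow_nonneg _ _) (gauss_nonneg _ _))]
      exact mul_le_of_le_one_left (gauss_nonneg _ _) (cutoffPow_le_one hα y))

theorem integral_cutoffPow_mul_gauss_le_one {α a : ℝ} (hα : 0 ≤ α) (ha : 0 < a) :
    ∫ y, cutoffPow α y * gauss a y ≤ 1 := by
  rw [← integral_gauss ha]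
  exact integral_mono (integrable_cutoffPow_mul_gauss hα ha) (integrable_gauss ha) fun y =>
    mul_le_of_le_one_left (gauss_nonneg _ _) (cutoffPow_le_one hα y)

/-- On `[-1, 1]` the cutoff is `1` and the kernels with `a ∈ [1, 2]` are uniformly bounded below.
This bounds the factors transverse to direction `i`. -/
theorem exists_le_integral_cutoffPow_mul_gauss {α : ℝ} (hα : 0 ≤ α) : ∃ κ : ℝ, 0 < κ ∧
    κ ≤ 1 ∧ ∀ a ∈ Icc (1 : ℝ) 2, κ ≤ ∫ y, cutoffPow α y * gauss a y := by
  have key : ∀ a ∈ Icc (1 : ℝ) 2, 2 * ((√(4 * Real.pi * 2))⁻¹ * Real.exp (-1)) ≤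
      ∫ y, cutoffPow α y * gauss a y := by
    intro a ha
    have ha0 : 0 < a := by linarith [ha.1]
    calc 2 * ((√(4 * Real.pi * 2))⁻¹ * Real.exp (-1))
        = ∫ _ in Icc (-1 : ℝ) 1, (√(4 * Real.pi * 2))⁻¹ * Real.exp (-1) := by
          rw [setIntegral_const, Measure.real, Real.volume_Icc, smul_eq_mul]
          norm_num
      _ ≤ ∫ y in Icc (-1 : ℝ) 1, cutoffPow α y * gauss a y := by
          refine setIntegral_mono_on (continuousOn_const.integrableOn_Icc) (integrable_cutoffPow_mul_gauss hα ha0).integrableOn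
            measurableSet_Icc fun y hy => ?_
          have hy' : |y| ≤ 1 := abs_le.2 hy
          rw [cutoffPow_eq_one hy', one_mul, gauss]
          have h1 : y ^ 2 ≤ 1 := (sq_le_one_iff_abs_le_one y).2 hy'
          have h2 : y ^ 2 / (4 * a) ≤ 1 := (div_le_one (by positivity)).2 (by linarith [ha.1])
          have h3 : 4 * Real.pi * a ≤ 4 * Real.pi * 2 :=
            mul_le_mul_of_nonneg_left ha.2 (by positivity)
          gcongr
      _ ≤ _ := setIntegral_le_integral (integrable_cutoffPow_mul_gauss hα ha0)
          (Eventually.of_forall fun y => mul_nonneg (cutoffPow_nonneg _ _) (gauss_nonneg _ _))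
  exact ⟨_, by positivity, (key 1 ⟨le_rfl, one_le_two⟩).trans
    (integral_cutoffPow_mul_gauss_le_one hα one_pos), key⟩

/-- The cutoff changes the integrand only where `|y| ≥ 1`; there `|y| ^ (α + 1) ≤ |y| ^ 5`, and the
weighted bound with `β = 5` is uniform in `a`. -/
theorem exists_integral_rpow_mul_cutoffPow_mul_hermFactor_le {α : ℝ} (hα₀ : 0 < α) (hα₂ : α < 2) :
    ∃ K C : ℝ, 0 < K ∧ 0 ≤ C ∧ ∀ a : ℝ, 0 < a →
      ∫ y : ℝ, |y| ^ α * y * cutoffPow α y * (hermFactor a y * gauss a y) ≤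
        -K * a ^ (α / 2 - 2) + C := by
  obtain ⟨K, hK, h⟩ := exists_integral_rpow_mul_hermFactor hα₀ hα₂
  obtain ⟨C, hC, h'⟩ := exists_abs_rpow_mul_hermFactor_le (β := 5) (by norm_num)
  refine ⟨K, C, hK, hC.le, fun a ha => ?_⟩
  rw [← h a ha]
  have hcont : Continuous fun y : ℝ => |y| ^ α * y :=
    (continuous_abs.rpow_const fun _ => Or.inr hα₀.le).mul continuous_id
  have hHk : Continuous fun y : ℝ => hermFactor a y * gauss a y :=
    (continuous_hermFactor a).mul (continuous_gauss a)
  have habs : ∀ y : ℝ, ‖|y| ^ α * y * (hermFactor a y * gauss a y)‖ =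
      |y| ^ (α + 1) * (|hermFactor a y| * gauss a y) := fun y => by
    rw [Real.rpow_add_one' (abs_nonneg y) (by linarith), norm_mul, norm_mul, norm_mul,
      Real.norm_eq_abs, Real.norm_eq_abs, Real.norm_eq_abs, Real.norm_eq_abs,
      abs_of_nonneg (gauss_nonneg a y), abs_of_nonneg (by positivity : 0 ≤ |y| ^ α)]
  have hi1 : Integrable fun y : ℝ => |y| ^ α * y * (hermFactor a y * gauss a y) :=
    (integrable_abs_rpow_mul_hermFactor (by linarith : 0 ≤ α + 1) ha).mono'
      (hcont.mul hHk).aestronglyMeasurable (Eventually.of_forall fun y => (habs y).le)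
  have hi2 : Integrable fun y : ℝ => |y| ^ α * y * cutoffPow α y *
      (hermFactor a y * gauss a y) := by
    refine hi1.norm.mono' ((hcont.mul (continuous_cutoffPow hα₀.le)).mul hHk).aestronglyMeasurable
      (Eventually.of_forall fun y => ?_)
    rw [mul_right_comm _ (cutoffPow α y), norm_mul _ (cutoffPow α y)]
    refine mul_le_of_le_one_right (norm_nonneg _) ?_
    rw [Real.norm_of_nonneg (cutoffPow_nonneg _ _)]
    exact cutoffPow_le_one hα₀.le y
  have hg := (integrable_gauss (by positivity : 0 < 2 * a)).const_mul C
  have key : ∀ y : ℝ, |y| ^ α * y * cutoffPow α y * (hermFactor a y * gauss a y) ≤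
      |y| ^ α * y * (hermFactor a y * gauss a y) + C * gauss (2 * a) y := by
    intro y
    rcases le_total |y| 1 with hy | hy
    · rw [cutoffPow_eq_one hy, mul_one]
      exact le_add_of_nonneg_right (mul_nonneg hC.le (gauss_nonneg _ _))
    · have h1 := h' a ha y
      rw [show (5 : ℝ) / 2 - 5 / 2 = 0 by norm_num, Real.rpow_zero, mul_one] at h1
      have h2 : ‖|y| ^ α * y * (hermFactor a y * gauss a y)‖ ≤ C * gauss (2 * a) y := by
        rw [habs]
        refine le_trans ?_ h1
        exact mul_le_mul_of_nonneg_right (Real.rpow_le_rpow_of_exponent_le hy (by linarith))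
          (mul_nonneg (abs_nonneg _) (gauss_nonneg _ _))
      have h3 := neg_le_of_abs_le (Real.norm_eq_abs _ ▸ h2)
      have h4 := cutoffPow_nonneg α y
      have h5 := cutoffPow_le_one hα₀.le y
      rw [mul_right_comm _ (cutoffPow α y)]
      have h6 := mul_nonneg (neg_le_iff_add_nonneg.1 h3) (sub_nonneg.2 h5)
      have h7 := mul_nonneg (mul_nonneg hC.le (gauss_nonneg (2 * a) y)) h4
      linarith
  calc _ ≤ ∫ y : ℝ, |y| ^ α * y * (hermFactor a y * gauss a y) + C * gauss (2 * a) y :=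
        integral_mono hi2 (hi1.add hg) key
    _ = _ := by
        rw [integral_add hi1 hg, integral_const_mul, integral_gauss (by positivity), mul_one]

/-- The initial value `x ↦ x i * ∏ j, ψ (x j)`, as a real function. -/
def oddBump (i : Fin N) (x : 𝔼) : ℝ := x i * ∏ j, cutoff (x j)

theorem contDiff_oddBump (i : Fin N) : ContDiff ℝ ∞ (oddBump i : 𝔼 → ℝ) := by
  have h : ∀ j : Fin N, ContDiff ℝ ∞ fun x : 𝔼 => x j := fun j => by fun_prop
  exact (h i).mul (contDiff_prod fun j _ => cutoff.contDiff.comp (h j))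

theorem hasCompactSupport_oddBump (i : Fin N) : HasCompactSupport (oddBump i : 𝔼 → ℝ) := by
  refine HasCompactSupport.intro (isCompact_closedBall (0 : 𝔼) (√(N * 2 ^ 2))) fun x hx => ?_
  by_contra h0
  refine hx ?_
  have h1 : ∀ j, |x j| ≤ 2 := fun j => by
    by_contra! h2
    exact h0 (mul_eq_zero_of_right _
      (Finset.prod_eq_zero (Finset.mem_univ j) (cutoff_eq_zero h2.le)))
  rw [mem_closedBall_zero_iff, EuclideanSpace.norm_eq]
  refine Real.sqrt_le_sqrt ?_
  calc ∑ j, ‖x j‖ ^ 2 ≤ ∑ _ : Fin N, (2 : ℝ) ^ 2 :=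
        Finset.sum_le_sum fun j _ => by
          rw [Real.norm_eq_abs]
          exact pow_le_pow_left₀ (abs_nonneg _) (h1 j) 2
    _ = _ := by simp

theorem abs_oddBump_le (i : Fin N) (x : 𝔼) : |oddBump i x| ≤ |x i| := by
  rw [oddBump, abs_mul, abs_of_nonneg (Finset.prod_nonneg fun j _ => cutoff.nonneg)]
  exact mul_le_of_le_one_right (abs_nonneg _)
    (Finset.prod_le_one (fun j _ => cutoff.nonneg) fun j _ => cutoff.le_one)

/-- The initial value `x ↦ x i * ∏ j, ψ (x j)`. -/
def initialValue (i : Fin N) : C₀(𝔼, ℂ) where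
  toFun x := (oddBump i x : ℂ)
  continuous_toFun := Complex.continuous_ofReal.comp (contDiff_oddBump i).continuous
  zero_at_infty' := by
    have h := ((hasCompactSupport_oddBump i).comp_left (g := fun r : ℝ => (r : ℂ)) rfl)
    exact h.is_zero_at_infty

theorem initialValue_apply (i : Fin N) (x : 𝔼) : initialValue i x = (oddBump i x : ℂ) := rfl

theorem contDiff_initialValue (i : Fin N) : ContDiff ℝ ∞ (initialValue i : 𝔼 → ℂ) :=
  Complex.ofRealCLM.contDiff.comp (contDiff_oddBump i)

theorem hasCompactSupport_initialValue (i : Fin N) :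
    HasCompactSupport (initialValue i : 𝔼 → ℂ) :=
  (hasCompactSupport_oddBump i).comp_left (g := fun r : ℝ => (r : ℂ)) rfl

theorem oddReflect_initialValue (i : Fin N) : oddReflect i (initialValue i) = initialValue i := by
  ext x
  have h : ∏ j, cutoff (reflect i x j) = ∏ j, cutoff (x j) := by
    refine Finset.prod_congr rfl fun j _ => ?_
    rw [reflect_apply]
    split_ifs
    · exact cutoff.neg _
    · rfl
  rw [oddReflect_apply, initialValue_apply, initialValue_apply, oddBump, oddBump, h,
    reflect_apply, if_pos rfl, neg_mul, Complex.ofReal_neg, neg_neg]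

theorem powerNonlinearity_ofReal (α r : ℝ) :
    powerNonlinearity α (r : ℂ) = ((|r| ^ α * r : ℝ) : ℂ) := by
  rw [powerNonlinearity, Complex.norm_real, Real.norm_eq_abs, ← Complex.ofReal_mul]

theorem abs_rpow_oddBump (α : ℝ) (i : Fin N) (x : 𝔼) :
    |oddBump i x| ^ α * oddBump i x = |x i| ^ α * x i * ∏ j, cutoffPow α (x j) := by
  have h : 0 ≤ ∏ j, cutoff (x j) := Finset.prod_nonneg fun j _ => cutoff.nonneg
  simp only [cutoffPow]
  rw [Finset.prod_mul_distrib, Real.finsetProd_rpow _ _ fun j _ => cutoff.nonneg, oddBump,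
    abs_mul, abs_of_nonneg h, Real.mul_rpow (abs_nonneg _) h]
  ring

/-- All functions involved are products over coordinates, so the integral factorises: direction `i`
gives the negative singular term and the others give factors between `κ` and `1`. -/
theorem exists_integral_testFun_mul_abs_rpow_oddBump_le {α : ℝ} (hα₀ : 0 < α) (hα₂ : α < 2) :
    ∃ K C : ℝ, 0 < K ∧ 0 ≤ C ∧ ∀ (i : Fin N) (c : Fin N → ℝ), 0 < c i →
      (∀ j, j ≠ i → c j ∈ Icc (1 : ℝ) 2) →
        ∫ x : 𝔼, testFun i c x * (|oddBump i x| ^ α * oddBump i x) ≤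
          -K * c i ^ (α / 2 - 2) + C := by
  obtain ⟨K, C, hK, hC, h⟩ := exists_integral_rpow_mul_cutoffPow_mul_hermFactor_le hα₀ hα₂
  obtain ⟨κ, hκ, hκ1, h'⟩ := exists_le_integral_cutoffPow_mul_gauss hα₀.le
  refine ⟨K * κ ^ N, C, by positivity, hC, fun i c hi hc => ?_⟩
  have h1 : ∀ x : 𝔼, testFun i c x * (|oddBump i x| ^ α * oddBump i x) =
      ∏ j, (fun (j : Fin N) (y : ℝ) =>
        if j = i then |y| ^ α * y * cutoffPow α y * (hermFactor (c i) y * gauss (c i) y)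
        else cutoffPow α y * gauss (c j) y) j (x j) := by
    intro x
    rw [abs_rpow_oddBump, testFun, gaussProd, ← Finset.mul_prod_erase _ _ (Finset.mem_univ i),
      ← Finset.mul_prod_erase _ (fun j => cutoffPow α (x j)) (Finset.mem_univ i),
      ← Finset.mul_prod_erase _ (fun j => (fun (j : Fin N) (y : ℝ) =>
        if j = i then |y| ^ α * y * cutoffPow α y * (hermFactor (c i) y * gauss (c i) y)
        else cutoffPow α y * gauss (c j) y) j (x j)) (Finset.mem_univ i)]
    have h2 : ∏ j ∈ Finset.univ.erase i, (fun (j : Fin N) (y : ℝ) =>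
        if j = i then |y| ^ α * y * cutoffPow α y * (hermFactor (c i) y * gauss (c i) y)
        else cutoffPow α y * gauss (c j) y) j (x j) =
        (∏ j ∈ Finset.univ.erase i, cutoffPow α (x j)) *
          ∏ j ∈ Finset.univ.erase i, gauss (c j) (x j) := by
      rw [← Finset.prod_mul_distrib]
      exact Finset.prod_congr rfl fun j hj => if_neg (Finset.ne_of_mem_erase hj)
    rw [h2]
    simp only [if_true]
    ring
  rw [integral_congr_ae (Eventually.of_forall h1)]
  refine (integral_prod_coord (fun (j : Fin N) (y : ℝ) =>
        if j = i then |y| ^ α * y * cutoffPow α y * (hermFactor (c i) y * gauss (c i) y)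
        else cutoffPow α y * gauss (c j) y)).trans_le ?_
  rw [← Finset.mul_prod_erase _ _ (Finset.mem_univ i)]
  simp only [if_true]
  have hle : ∀ j ∈ Finset.univ.erase i, κ ≤ ∫ y : ℝ, (if j = i then
      |y| ^ α * y * cutoffPow α y * (hermFactor (c i) y * gauss (c i) y)
      else cutoffPow α y * gauss (c j) y) ∧ ∫ y : ℝ, (if j = i then
      |y| ^ α * y * cutoffPow α y * (hermFactor (c i) y * gauss (c i) y)
      else cutoffPow α y * gauss (c j) y) ≤ 1 := fun j hj => by
    simp only [if_neg (Finset.ne_of_mem_erase hj)]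
    have hj' := hc j (Finset.ne_of_mem_erase hj)
    exact ⟨h' _ hj', integral_cutoffPow_mul_gauss_le_one hα₀.le (by linarith [hj'.1])⟩
  set P := ∏ j ∈ Finset.univ.erase i, ∫ y : ℝ, (if j = i then
      |y| ^ α * y * cutoffPow α y * (hermFactor (c i) y * gauss (c i) y)
      else cutoffPow α y * gauss (c j) y) with hP
  have hP1 : P ≤ 1 := Finset.prod_le_one (fun j hj => hκ.le.trans (hle j hj).1)
    fun j hj => (hle j hj).2
  have hP0 : κ ^ N ≤ P := by
    calc κ ^ N ≤ κ ^ (Finset.univ.erase i).card :=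
          pow_le_pow_of_le_one hκ.le hκ1 (by simp)
      _ = ∏ _j ∈ Finset.univ.erase i, κ := by rw [Finset.prod_const]
      _ ≤ P := Finset.prod_le_prod (fun _ _ => hκ.le) fun j hj => (hle j hj).1
  have h3 := h (c i) hi
  have h4 : 0 ≤ P := (by positivity : 0 ≤ κ ^ N).trans hP0
  -- The two terms have opposite signs, so the lower bound on `P` is used for the singular one and
  -- the upper bound for `C`.
  calc _ ≤ (-K * c i ^ (α / 2 - 2) + C) * P := mul_le_mul_of_nonneg_right h3 h4
    _ = -(K * c i ^ (α / 2 - 2)) * P + C * P := by ring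
    _ ≤ -(K * c i ^ (α / 2 - 2)) * κ ^ N + C * 1 :=
        add_le_add (mul_le_mul_of_nonpos_left hP0 (neg_nonpos.2 (by positivity)))
          (mul_le_mul_of_nonneg_left hP1 hC)
    _ = _ := by ring

/-- Functions close to the initial value, relative to `|x i|`, have a nonlinear term of the same
singular behaviour. -/
theorem exists_re_integral_testFun_smul_powerC₀_le {α : ℝ} (hα₀ : 0 < α) (hα₂ : α < 2) :
    ∃ η κ C : ℝ, 0 < η ∧ 0 < κ ∧ 0 ≤ C ∧ ∀ (i : Fin N) (v : C₀(𝔼, ℂ)),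
      (∀ x, ‖v x - initialValue i x‖ ≤ η * |x i|) → ∀ c : Fin N → ℝ, 0 < c i →
        (∀ j, j ≠ i → c j ∈ Icc (1 : ℝ) 2) →
          (∫ x, testFun i c x • powerC₀ α hα₀ v x).re ≤ -κ * c i ^ (α / 2 - 2) + C := by
  obtain ⟨K, C, hK, hC, h⟩ := exists_integral_testFun_mul_abs_rpow_oddBump_le (N := N) hα₀ hα₂
  obtain ⟨D, hD, h'⟩ := exists_integral_abs_rpow_mul_testFun_le (N := N)
    (by linarith : 0 ≤ α + 1)
  set M := (2 + α) * 2 ^ α * D with hM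
  have hM0 : 0 < M := by positivity
  -- With this `η` the perturbation consumes at most half of the singular term, leaving `κ = K / 2`.
  refine ⟨min 1 (K / (2 * M)), K / 2, C, by positivity, by positivity, hC,
    fun i v hv c hi hc => ?_⟩
  set η := min 1 (K / (2 * M)) with hη
  have hη0 : 0 < η := by positivity
  have hη1 : η ≤ 1 := min_le_left _ _
  have hη2 : η * M ≤ K / 2 := by
    calc η * M ≤ K / (2 * M) * M := mul_le_mul_of_nonneg_right (min_le_right _ _) hM0.le
      _ = K / 2 := by field_simp
  have hc0 : ∀ j, 0 < c j := fun j => by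
    rcases eq_or_ne j i with rfl | hj
    · exact hi
    · linarith [(hc j hj).1]
  obtain ⟨hint, hle⟩ := h' i c hc0
  have hT := integrable_testFun i hc0
  have hmain : (∫ x, testFun i c x • powerC₀ α hα₀ (initialValue i) x) =
      ((∫ x : 𝔼, testFun i c x * (|oddBump i x| ^ α * oddBump i x) : ℝ) : ℂ) := by
    rw [← integral_complex_ofReal]
    refine integral_congr_ae (Eventually.of_forall fun x => ?_)
    simp only
    rw [powerC₀_apply, initialValue_apply, powerNonlinearity_ofReal, Complex.real_smul,
      ← Complex.ofReal_mul]
  have hdiff : ‖(∫ x, testFun i c x • powerC₀ α hα₀ v x) -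
      ∫ x, testFun i c x • powerC₀ α hα₀ (initialValue i) x‖ ≤ K / 2 * c i ^ (α / 2 - 2) := by
    rw [← integral_sub (integrable_smul_apply hT _) (integrable_smul_apply hT _)]
    refine (norm_integral_le_of_norm_le (hint.const_mul ((2 + α) * 2 ^ α * η))
      (Eventually.of_forall fun x => ?_)).trans ?_
    · rw [← smul_sub, norm_smul, powerC₀_apply, powerC₀_apply, Real.norm_eq_abs]
      have h1 : ‖initialValue i x‖ ≤ |x i| := by
        rw [initialValue_apply, Complex.norm_real]
        exact abs_oddBump_le i x
      have h2 : ‖v x‖ ≤ 2 * |x i| := by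
        have h3 := norm_le_norm_add_norm_sub' (v x) (initialValue i x)
        have h4 : η * |x i| ≤ 1 * |x i| := mul_le_mul_of_nonneg_right hη1 (abs_nonneg _)
        linarith [hv x]
      have h3 := norm_powerNonlinearity_sub_le hα₀ h2
        (h1.trans (by linarith [abs_nonneg (x i)] : |x i| ≤ 2 * |x i|))
      calc |testFun i c x| * ‖powerNonlinearity α (v x) - powerNonlinearity α (initialValue i x)‖
          ≤ |testFun i c x| * ((2 + α) * (2 * |x i|) ^ α * (η * |x i|)) :=
            mul_le_mul_of_nonneg_left (h3.trans (mul_le_mul_of_nonneg_left (hv x)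
              (by positivity))) (abs_nonneg _)
        _ = _ := by
            rw [Real.mul_rpow two_pos.le (abs_nonneg _),
              Real.rpow_add_one' (abs_nonneg _) (by linarith)]
            ring
    · rw [integral_const_mul]
      rw [show (α + 1) / 2 - 5 / 2 = α / 2 - 2 by ring] at hle
      calc (2 + α) * 2 ^ α * η * ∫ x : 𝔼, |x i| ^ (α + 1) * |testFun i c x|
          ≤ (2 + α) * 2 ^ α * η * (D * c i ^ (α / 2 - 2)) :=
            mul_le_mul_of_nonneg_left hle (by positivity)
        _ = η * M * c i ^ (α / 2 - 2) := by rw [hM]; ring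
        _ ≤ _ := mul_le_mul_of_nonneg_right hη2 (by positivity)
  rw [hmain] at hdiff
  have h5 := (Complex.re_le_norm _).trans hdiff
  rw [Complex.sub_re, Complex.ofReal_re] at h5
  have h6 := h i c hi hc
  linarith

/-! ### Blow-up of the pairings along a solution -/

/-- Exact integration in `r = a + (t - s)`, followed by `(a + t) ^ (β + 1) ≤ t ^ (β + 1)`; the
remaining term diverges as `a → 0`. -/
theorem le_integral_rpow_add_sub {β a t : ℝ} (hβ : β < -1) (ha : 0 < a) (ht : 0 < t) :
    IntervalIntegrable (fun s => (a + (t - s)) ^ β) volume 0 t ∧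
      (a ^ (β + 1) - t ^ (β + 1)) / -(β + 1) ≤ ∫ s in (0 : ℝ)..t, (a + (t - s)) ^ β := by
  constructor
  · refine ContinuousOn.intervalIntegrable fun s hs => ?_
    rw [uIcc_of_le ht.le] at hs
    have h : a + (t - s) ≠ 0 := by linarith [hs.2]
    have h' : Continuous fun s => a + (t - s) := by fun_prop
    exact (h'.continuousAt.rpow_const (Or.inl h)).continuousWithinAt
  · have h := intervalIntegral.integral_comp_sub_left (a := 0) (b := t) (fun r : ℝ => r ^ β) (a + t)
    simp only [add_sub_assoc] at h
    rw [h, sub_self, add_zero, sub_zero, integral_rpow (Or.inr ⟨hβ.ne, fun h0 => ?_⟩), div_neg,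
      ← neg_div]
    · refine div_le_div_of_nonpos_of_le (by linarith) ?_
      linarith [Real.rpow_le_rpow_of_nonpos ht (by linarith : t ≤ a + t)
        (by linarith : β + 1 ≤ 0)]
    · rw [uIcc_of_le (by linarith)] at h0
      linarith [h0.1]

/-- Duhamel's formula, tested against `testFun i c`. -/
theorem IsSolution.integral_testFun_smul_eq (i : Fin N) {c : Fin N → ℝ} (hc : ∀ j, 0 < c j)
    {α : ℝ} (hα : 0 < α) {lam : ℂ} {φ : C₀(𝔼, ℂ)} {T : EReal} {u : ℝ → C₀(𝔼, ℂ)}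
    (hu : IsSolution α lam φ T u) {t : ℝ} (ht : 0 ≤ t) (hT : (t : EReal) < T) :
    IntervalIntegrable (fun s => ∫ x, testFun i (fun j => c j + (t - s)) x • powerC₀ α hα (u s) x)
      volume 0 t ∧
    ∫ x, testFun i c x • u t x = (∫ x, testFun i (fun j => c j + t) x • φ x) +
      lam * ∫ s in (0 : ℝ)..t,
        ∫ x, testFun i (fun j => c j + (t - s)) x • powerC₀ α hα (u s) x := by
  have hu' := (isSolution_iff hα lam φ T u).1 hu
  have hint := intervalIntegrable_mildIntegrand (isMildPair_heatOp hα) ht (hu'.1.mono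
    fun s hs => ⟨hs.1, lt_of_le_of_lt (EReal.coe_le_coe_iff.2 hs.2) hT⟩)
  set g := pairCLM (testFun i c) (integrable_testFun i hc) with hg
  have h1 : ∀ s ∈ uIcc 0 t, g (heatOp (t - s) (powerC₀ α hα (u s))) =
      ∫ x, testFun i (fun j => c j + (t - s)) x • powerC₀ α hα (u s) x := fun s hs => by
    rw [uIcc_of_le ht] at hs
    rw [hg, pairCLM_apply, integral_testFun_smul_heatOp i hc (sub_nonneg.2 hs.2)]
  constructor
  · exact (show IntervalIntegrable _ volume 0 t from
      ⟨g.integrable_comp hint.1, g.integrable_comp hint.2⟩).congr fun s hs => h1 s (uIoc_subset_uIcc hs)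
  · rw [← pairCLM_apply (integrable_testFun i hc), ← hg, hu'.2 t ht hT, mildMap, map_add, map_smul,
      ← ContinuousLinearMap.intervalIntegral_comp_comm _ hint, smul_eq_mul,
      intervalIntegral.integral_congr h1, hg, pairCLM_apply,
      integral_testFun_smul_heatOp i hc ht]

/-- A lower bound for the nonlinear term along a solution excludes Sobolev regularity. -/
theorem IsSolution.not_memHsp (i : Fin N) {α : ℝ} (hα₀ : 0 < α) (hα₂ : α < 2) {lam : ℂ}
    (hlam : lam ≠ 0) {κ C : ℝ} (hκ : 0 < κ) {φ : C₀(𝔼, ℂ)} (hφ : Integrable φ) {T : EReal}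
    {u : ℝ → C₀(𝔼, ℂ)} (hu : IsSolution α lam φ T u) {t : ℝ} (ht : 0 < t) (ht1 : t ≤ 1)
    (hT : (t : EReal) < T) (h : ∀ s ∈ Icc 0 t, ∀ c : Fin N → ℝ, 0 < c i →
      (∀ j, j ≠ i → c j ∈ Icc (1 : ℝ) 2) →
        (∫ x, testFun i c x • powerC₀ α hα₀ (u s) x).re ≤ -κ * c i ^ (α / 2 - 2) + C)
    {p : ℝ≥0∞} [Fact (1 ≤ p)] (hp : 1 < p) (hp' : p < ⊤) {s : ℝ} (hs : 5 + 1 / p.toReal < s) :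
    ¬ MemHsp s p (u t) := by
  intro hv
  obtain ⟨B, hB⟩ := exists_norm_integral_testFun_le_of_memHsp hp hp' hs hv i
  obtain ⟨D, hD, hD'⟩ := exists_abs_testFun_le (N := N)
  set A := D * t ^ (-3 : ℝ) * ∫ x, ‖φ x‖ with hA
  have hγ : 0 < 1 - α / 2 := by linarith
  have key : ∀ a : ℝ, 0 < a → κ * ((a ^ (α / 2 - 1) - t ^ (α / 2 - 1)) / (1 - α / 2)) ≤
      C * t + ‖lam‖⁻¹ * (B + A) := by
    intro a ha
    -- Transverse widths start at `1`; since `t ≤ 1`, adding `t - s` keeps them in `[1, 2]`.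
    set c : Fin N → ℝ := Function.update (fun _ => 1) i a with hcdef
    have hci : c i = a := Function.update_self ..
    have hcj : ∀ j, j ≠ i → c j = 1 := fun j hj => Function.update_of_ne hj ..
    have hc : ∀ j, 0 < c j := fun j => by
      rcases eq_or_ne j i with rfl | hj
      · rwa [hci]
      · rw [hcj j hj]; exact one_pos
    obtain ⟨hint, heq⟩ := hu.integral_testFun_smul_eq i hc hα₀ ht.le hT
    set J : ℝ → ℂ := fun s => ∫ x, testFun i (fun j => c j + (t - s)) x • powerC₀ α hα₀ (u s) x
      with hJ
    have h1 : ‖∫ x, testFun i c x • u t x‖ ≤ B := hB c (hc i) fun j hj => (hcj j hj).ge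
    have h2 : ‖∫ x, testFun i (fun j => c j + t) x • φ x‖ ≤ A := by
      rw [hA, ← integral_const_mul]
      refine norm_integral_le_of_norm_le (hφ.norm.const_mul _) (Eventually.of_forall fun x => ?_)
      rw [norm_smul, Real.norm_eq_abs]
      refine mul_le_mul_of_nonneg_right ((hD' i _ (add_pos (hc i) ht) (fun j hj => ?_) x).trans
        (mul_le_mul_of_nonneg_left ?_ hD.le)) (norm_nonneg _)
      · rw [hcj j hj]; linarith
      · exact Real.rpow_le_rpow_of_nonpos ht (by linarith [hc i]) (by norm_num)
    -- Dividing by `lam` before taking real parts makes the argument independent of the phase of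
    -- `lam`.
    have h3 : ‖∫ s in (0 : ℝ)..t, J s‖ ≤ ‖lam‖⁻¹ * (B + A) := by
      have h4 : lam * ∫ s in (0 : ℝ)..t, J s = (∫ x, testFun i c x • u t x) -
          ∫ x, testFun i (fun j => c j + t) x • φ x := by rw [heq]; ring
      rw [← inv_mul_cancel_left₀ hlam (∫ s in (0 : ℝ)..t, J s), h4, norm_mul, norm_inv]
      exact mul_le_mul_of_nonneg_left ((norm_sub_le _ _).trans (add_le_add h1 h2)) (by positivity)
    have h5 : ∀ s ∈ Icc 0 t, (J s).re ≤ -κ * (a + (t - s)) ^ (α / 2 - 2) + C := fun s hs => by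
      have h6 := h s hs (fun j => c j + (t - s)) (add_pos_of_pos_of_nonneg (hc i)
        (sub_nonneg.2 hs.2)) fun j hj => by
          rw [hcj j hj]
          exact ⟨by linarith [hs.2], by linarith [hs.1]⟩
      simpa only [hci] using h6
    obtain ⟨hi, hle⟩ := le_integral_rpow_add_sub (by linarith : α / 2 - 2 < -1) ha ht
    have h7 : (∫ s in (0 : ℝ)..t, J s).re ≤
        -κ * (∫ s in (0 : ℝ)..t, (a + (t - s)) ^ (α / 2 - 2)) + C * t := by
      have h8 : (∫ s in (0 : ℝ)..t, J s).re = ∫ s in (0 : ℝ)..t, (J s).re :=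
        (Complex.reCLM.intervalIntegral_comp_comm hint).symm
      rw [h8]
      refine (intervalIntegral.integral_mono_on ht.le
        ⟨Complex.reCLM.integrable_comp hint.1, Complex.reCLM.integrable_comp hint.2⟩
        ((hi.const_mul (-κ)).add intervalIntegrable_const) h5).trans_eq ?_
      rw [intervalIntegral.integral_add (hi.const_mul (-κ)) intervalIntegrable_const,
        intervalIntegral.integral_const_mul, intervalIntegral.integral_const, smul_eq_mul]
      ring
    have h9 := (Complex.abs_re_le_norm _).trans h3
    have h10 := neg_le_of_abs_le h9
    rw [show α / 2 - 2 + 1 = α / 2 - 1 by ring,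
      show -(α / 2 - 1) = 1 - α / 2 by ring] at hle
    have h11 := mul_le_mul_of_nonneg_left hle hκ.le
    linarith
  have htend := tendsto_rpow_neg_nhdsGT_zero (by linarith : α / 2 - 1 < 0)
  -- This is the upper bound that `key` imposes on `a ^ (α / 2 - 1)` for every `a > 0`; the negative
  -- exponent violates it for small `a`.
  set R := (C * t + ‖lam‖⁻¹ * (B + A)) / κ * (1 - α / 2) + t ^ (α / 2 - 1) with hR
  obtain ⟨a, ha, ha0⟩ := ((htend.eventually_gt_atTop R).and self_mem_nhdsWithin).exists
  have h1 := key a ha0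
  rw [← le_div_iff₀' hκ, div_le_iff₀ hγ] at h1
  linarith

end SemilinearHeat

end

theorem theorem1p4 (N : ℕ) (hN : 1 ≤ N) (α : ℝ) (hα₀ : 0 < α) (hα₂ : α < 2)
    (lam : ℂ) (hlam : lam ≠ 0) :
    ∃ φ : EuclideanSpace ℝ (Fin N) → ℂ, ContDiff ℝ ∞ φ ∧ HasCompactSupport φ ∧
      ∃ (T : EReal) (u : ℝ → C₀(EuclideanSpace ℝ (Fin N), ℂ)),
        SemilinearHeat.IsMaximalSolution α lam φ T u ∧
        ∃ δ : ℝ, 0 < δ ∧ (δ : EReal) ≤ T ∧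
          ∀ t : ℝ, 0 < t → t < δ →
            ∀ (p : ℝ≥0∞) [Fact (1 ≤ p)], 1 < p → p < ⊤ →
              ∀ s : ℝ, 5 + 1 / p.toReal < s → ¬ SemilinearHeat.MemHsp s p (u t) := by
  set i : Fin N := ⟨0, hN⟩
  have hφc := SemilinearHeat.hasCompactSupport_initialValue i
  refine ⟨SemilinearHeat.initialValue i, SemilinearHeat.contDiff_initialValue i, hφc, ?_⟩
  obtain ⟨T, u, hu⟩ := SemilinearHeat.exists_isMaximalSolution hα₀ lam
    (SemilinearHeat.initialValue i)
  obtain ⟨η, κ, C, hη, hκ, -, h⟩ :=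
    SemilinearHeat.exists_re_integral_testFun_smul_powerC₀_le (N := N) hα₀ hα₂
  obtain ⟨b, hb0, hbT⟩ := EReal.lt_iff_exists_real_btwn.1 hu.pos
  have hb : 0 < b := EReal.coe_pos.1 hb0
  obtain ⟨L, hL, hL'⟩ := hu.isSolution.exists_norm_sub_le i hα₀
    (SemilinearHeat.oddReflect_initialValue i) (SemilinearHeat.contDiff_initialValue i) hφc hbT
  -- The three terms keep `t` inside the existence interval, the transverse widths in `[1, 2]`, and
  -- `L * √r ≤ η`; `L + 1` avoids dividing by zero.
  refine ⟨T, u, hu, min (min b 1) ((η / (L + 1)) ^ 2), by positivity,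
    (EReal.coe_le_coe_iff.2 ((min_le_left _ _).trans (min_le_left _ _))).trans hbT.le,
    fun t ht htδ p _ hp hp' s hs => ?_⟩
  have htb : t ≤ b := htδ.le.trans ((min_le_left _ _).trans (min_le_left _ _))
  have ht1 : t ≤ 1 := htδ.le.trans ((min_le_left _ _).trans (min_le_right _ _))
  have htη : t ≤ (η / (L + 1)) ^ 2 := htδ.le.trans (min_le_right _ _)
  refine hu.isSolution.not_memHsp i hα₀ hα₂ hlam hκ
    ((SemilinearHeat.initialValue i).continuous.integrable_of_hasCompactSupport hφc) ht ht1
    (lt_of_le_of_lt (EReal.coe_le_coe_iff.2 htb) hbT)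
    (fun r hr c => h i (u r) (fun x => ?_) c) hp hp' hs
  refine (hL' r ⟨hr.1, hr.2.trans htb⟩ x).trans (mul_le_mul_of_nonneg_right ?_ (abs_nonneg _))
  have h1 : √r ≤ η / (L + 1) := Real.sqrt_le_iff.2 ⟨by positivity, hr.2.trans htη⟩
  calc L * √r ≤ (L + 1) * (η / (L + 1)) :=
        mul_le_mul (by linarith) h1 (Real.sqrt_nonneg _) (by linarith)
    _ = η := by field_simp
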